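/- **Definitions.** A $P$-operator is a linear operator $A:L^\infty(\Omega)\to L^1(\Omega)$, $v\mapsto vA$ (real-valued functions), on some probability space $(\Omega,\mathcal A,\mu)$, such that $\|A\|_{\infty\to1}:=\sup_{v\ne 0}\|vA\|_1/\|v\|_\infty<\infty$. A real $n\times n$ matrix $A$ ($n\ge 1$) is regarded as the $P$-operator $v\mapsto vA$, $(vA)_j=\sum_i v_iA_{ij}$, on $[n]=\{1,\dots,n\}$ with the uniform probability measure. For $k\ge 1$, the $k$-profile $\mathcal S_k(A)$ of a $P$-operator $A$ is the set of all joint distributions on $\mathbb R^{2k}$ of $(v_1,\dots,v_k,v_1A,\dots,v_kA)$, where $v_1,\dots,v_k$ run through the measurable functions $\Omega\to[-1,1]$. For $P$-operators $A,B$ (possibly on different probability spaces) put $$d_M(A,B):=\sum_{k=1}^\infty 2^{-k}\,d_H(\mathcal S_k(A),\mathcal S_k(B)),$$ where $d_H$ is the Hausdorff distance between sets of Borel probability measures on $\mathbb R^{2k}$ with respect to the Lévy–Prokhorov metric (and the Euclidean metric on $\mathbb R^{2k}$). **Proposition 11.1.** For every infinite set $S'\subseteq\mathbb N=\{1,2,\dots\}$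 there are a $P$-operator $A$ and an infinite set $S\subseteq S'$ (both deterministic) such that the following holds. Let $(H_n)_{n\ge1}$ be random matrices defined on a common probability space, where for each $n$ the matrix $H_n$ is $n\times n$ with independent entries, each uniformly distributed on $\{n^{-1/2},-n^{-1/2}\}$; no assumption is made on the joint distribution of $H_n$ for different $n$. Then, with probability $1$, the sequence $(H_j)_{j\in S}$ converges to $A$ in $d_M$, that is, $d_M(H_j,A)\to0$ as $j\to\infty$, $j\in S$. -/

import Mathlib

open MeasureTheory ProbabilityTheory Filter Topology
open scoped ENNReal

noncomputable section

/-- A `P`-operator: a linear operator `A : L^∞(Ω) → L^1(Ω)` with `‖A‖_{∞→1} < ∞`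
on some probability space `(Ω, μ)`. A linear operator between normed spaces has finite operator norm
iff it is continuous, so this is a continuous linear map. -/
structure POperator where
  /-- The underlying set of the probability space. -/
  Space : Type
  /-- The σ-algebra. -/
  mSpace : MeasurableSpace Space
  /-- The probability measure. -/
  measure : Measure Space
  isProb : IsProbabilityMeasure measure
  /-- The operator. -/
  op : Lp ℝ ∞ measure →L[ℝ] Lp ℝ 1 measure

attribute [instance] POperator.mSpace POperator.isProb

namespace POperator

/-- `ℝ^{2k}` with the Euclidean metric; the first `k` coordinates are `Sum.inl i`, the last `k` ones
are `Sum.inr i`. -/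
abbrev ProfileSpace (k : ℕ) : Type := EuclideanSpace ℝ (Fin k ⊕ Fin k)

/-- The map `x ↦ (v₁(x), …, vₖ(x), (v₁A)(x), …, (vₖA)(x))`. -/
def jointMap (A : POperator) {k : ℕ} (v : Fin k → Lp ℝ ∞ A.measure) (x : A.Space) :
    ProfileSpace k :=
  WithLp.toLp 2 (Sum.elim (fun i => v i x) (fun i => A.op (v i) x))

theorem aemeasurable_jointMap (A : POperator) {k : ℕ} (v : Fin k → Lp ℝ ∞ A.measure) :
    AEMeasurable (A.jointMap v) A.measure := by
  refine (WithLp.measurable_toLp 2 (Fin k ⊕ Fin k → ℝ)).comp_aemeasurable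
    (aemeasurable_pi_lambda _ ?_)
  rintro (i | i)
  · exact (Lp.aestronglyMeasurable (v i)).aemeasurable
  · exact (Lp.aestronglyMeasurable (A.op (v i))).aemeasurable

/-- The joint distribution `𝒟_A(v₁, …, vₖ)` of `v₁, …, vₖ, v₁A, …, vₖA`, a point of the space of Borel
probability measures on `ℝ^{2k}` with the Lévy–Prokhorov metric. -/
def jointLaw (A : POperator) {k : ℕ} (v : Fin k → Lp ℝ ∞ A.measure) :
    LevyProkhorov (ProbabilityMeasure (ProfileSpace k)) :=
  LevyProkhorov.ofMeasure
    ⟨A.measure.map (A.jointMap v), Measure.isProbabilityMeasure_map (A.aemeasurable_jointMap v)⟩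

/-- The `k`-profile `𝒮ₖ(A)`: all `𝒟_A(v₁, …, vₖ)` with `v₁, …, vₖ` taking values in `[-1, 1]`. -/
def profile (A : POperator) (k : ℕ) : Set (LevyProkhorov (ProbabilityMeasure (ProfileSpace k))) :=
  {η | ∃ v : Fin k → Lp ℝ ∞ A.measure,
    (∀ i, ∀ᵐ x ∂A.measure, v i x ∈ Set.Icc (-1 : ℝ) 1) ∧ η = A.jointLaw v}

/-- The distance `d_M(A, B) = ∑_{k ≥ 1} 2^{-k} d_H(𝒮ₖ(A), 𝒮ₖ(B))`, where `d_H` is the Hausdorff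
distance with respect to the Lévy–Prokhorov metric. It is at most `1`, see `POperator.dM_le_one`. -/
def dM (A B : POperator) : ℝ≥0∞ :=
  ∑' k : ℕ, (2⁻¹ : ℝ≥0∞) ^ (k + 1) *
    Metric.hausdorffEDist (A.profile (k + 1)) (B.profile (k + 1))

theorem profile_nonempty (A : POperator) (k : ℕ) : (A.profile k).Nonempty := by
  refine ⟨A.jointLaw (fun _ => 0), fun _ => 0, fun i => ?_, rfl⟩
  filter_upwards [Lp.coeFn_zero ℝ ∞ A.measure] with x hx
  rw [hx]
  simp

theorem dM_le_one (A B : POperator) : dM A B ≤ 1 := by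
  have key : ∀ k, Metric.hausdorffEDist (A.profile k) (B.profile k) ≤ 1 := by
    intro k
    have h : ∀ x y : LevyProkhorov (ProbabilityMeasure (ProfileSpace k)), edist x y ≤ 1 := by
      intro x y
      rw [LevyProkhorov.edist_probabilityMeasure_def]
      refine (levyProkhorovEDist_le_max_measure_univ _ _).trans ?_
      simp
    obtain ⟨a, ha⟩ := A.profile_nonempty k
    obtain ⟨b, hb⟩ := B.profile_nonempty k
    exact Metric.hausdorffEDist_le_of_mem_edist (fun x _ => ⟨b, hb, h x b⟩)
      (fun y _ => ⟨a, ha, h y a⟩)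
  calc dM A B ≤ ∑' k : ℕ, (2⁻¹ : ℝ≥0∞) ^ (k + 1) :=
        ENNReal.tsum_le_tsum fun k => mul_le_of_le_one_right' (key _)
    _ = 1 := by
        rw [ENNReal.tsum_geometric_add_one, ENNReal.one_sub_inv_two, inv_inv]
        exact ENNReal.inv_mul_cancel two_ne_zero ENNReal.ofNat_ne_top

end POperator

/-- The uniform probability measure on `[n]`. -/
abbrev uniformFin (n : ℕ) : Measure (Fin n) := uniformOn Set.univ

theorem forall_of_ae_uniformFin {n : ℕ} {p : Fin n → Prop}
    (h : ∀ᵐ x ∂uniformFin n, p x) (x : Fin n) : p x := by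
  by_contra hx
  have h0 : uniformFin n {x} = 0 := measure_mono_null (by simpa using hx) (ae_iff.1 h)
  rw [uniformOn_univ] at h0
  simp at h0

namespace Matrix

/-- The action `v ↦ vA` of a matrix on row vectors, `(vA)_j = ∑ i, v_i A_{ij}`, where vectors are
viewed as functions on the uniform probability space `[n]`. -/
def rowAction {n : ℕ} [NeZero n] (A : Matrix (Fin n) (Fin n) ℝ) :
    Lp ℝ ∞ (uniformFin n) →L[ℝ] Lp ℝ 1 (uniformFin n) :=
  LinearMap.mkContinuousOfExistsBound
    { toFun := fun v => (MemLp.of_discrete (f := Matrix.vecMul (v : Fin n → ℝ) A)).toLp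
      map_add' := fun v w => by
        have h : ((v + w : Lp ℝ ∞ (uniformFin n)) : Fin n → ℝ) = ⇑v + ⇑w :=
          funext (forall_of_ae_uniformFin (Lp.coeFn_add v w))
        rw [← MemLp.toLp_add]
        congr 1
        rw [h, Matrix.add_vecMul]
      map_smul' := fun c v => by
        have h : ((c • v : Lp ℝ ∞ (uniformFin n)) : Fin n → ℝ) = c • ⇑v :=
          funext (forall_of_ae_uniformFin (Lp.coeFn_smul c v))
        rw [RingHom.id_apply, ← MemLp.toLp_const_smul]
        congr 1
        rw [h, Matrix.smul_vecMul] }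
    ⟨∑ i, ∑ j, |A i j|, fun v => by
      have hC : 0 ≤ (∑ i, ∑ j, |A i j|) * ‖v‖ := by positivity
      have hv : ∀ i, ‖v i‖ ≤ ‖v‖ := forall_of_ae_uniformFin (by
        have h := ae_le_lpNorm_exponent_top (Lp.memLp v)
        rwa [← toReal_eLpNorm (Lp.aestronglyMeasurable v), ← Lp.norm_def] at h)
      refine (Lp.norm_le_of_ae_bound hC ?_).trans_eq (by simp [measureUnivNNReal])
      filter_upwards [MemLp.coeFn_toLp
        (MemLp.of_discrete (p := 1) (μ := uniformFin n) (f := Matrix.vecMul (⇑v) A))] with j hj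
      refine (congrArg norm hj).trans_le ?_
      calc ‖Matrix.vecMul (⇑v) A j‖ = ‖∑ i, v i * A i j‖ := rfl
        _ ≤ ∑ i, ‖v i * A i j‖ := norm_sum_le _ _
        _ ≤ ∑ i, (∑ j, |A i j|) * ‖v‖ := by
          refine Finset.sum_le_sum fun i _ => ?_
          rw [norm_mul, mul_comm]
          exact mul_le_mul (Finset.single_le_sum (f := fun j => |A i j|)
            (fun j _ => abs_nonneg _) (Finset.mem_univ j)) (hv i) (norm_nonneg _) (by positivity)
        _ = (∑ i, ∑ j, |A i j|) * ‖v‖ := by rw [Finset.sum_mul]⟩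

theorem rowAction_apply {n : ℕ} [NeZero n] (A : Matrix (Fin n) (Fin n) ℝ)
    (v : Lp ℝ ∞ (uniformFin n)) (j : Fin n) : A.rowAction v j = ∑ i, v i * A i j :=
  forall_of_ae_uniformFin (MemLp.coeFn_toLp
    (MemLp.of_discrete (p := 1) (μ := uniformFin n) (f := Matrix.vecMul (⇑v) A))) j

/-- A real `n × n` matrix as a `P`-operator on the uniform probability space `[n]`. -/
def toPOperator {n : ℕ} [NeZero n] (A : Matrix (Fin n) (Fin n) ℝ) : POperator where
  Space := Fin n
  mSpace := inferInstance
  measure := uniformFin n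
  isProb := inferInstance
  op := A.rowAction

end Matrix

/-- The uniform distribution on `{n^{-1/2}, -n^{-1/2}}`. -/
def signLaw (n : ℕ) : Measure ℝ :=
  (2⁻¹ : ℝ≥0∞) • Measure.dirac (Real.sqrt n)⁻¹ + (2⁻¹ : ℝ≥0∞) • Measure.dirac (-(Real.sqrt n)⁻¹)

/-- `H` is a random `n × n` matrix on `(Ω, P)` with i.i.d. entries uniform on `±n^{-1/2}`. -/
structure IsRandomSignMatrix {Ω : Type*} [MeasurableSpace Ω] (P : Measure Ω) {n : ℕ}
    (H : Ω → Matrix (Fin n) (Fin n) ℝ) : Prop where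
  hasLaw : ∀ i j, HasLaw (fun ω => H ω i j) (signLaw n) P
  indep : iIndepFun (fun (p : Fin n × Fin n) ω => H ω p.1 p.2) P

end

/-! The proof combines concentration of measure with a compactness argument.

Fix a measure `η`. The distance from `η` to the `k`-profile of a sign matrix is a function of its
`n` independent columns. Changing one column alters `vH` at one point of mass `1/n`, so this
distance moves by at most `1/n` (`abs_infDistProfile_sub_le`). McDiarmid's inequality then puts it
within `t` of a deterministic mean, up to probability `2 exp(-n t² / 2)`. These bounds are summable,
so Borel–Cantelli applies whatever the joint law of the matrices for different `n`.

Almost surely a sign matrix is also eventually bounded by `4` as a map `L^∞ → L²` and `L² → L¹`. All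
profiles of such matrices lie in one totally bounded set, so countably many `η`, taken from finite
nets, control the Hausdorff distances. Two sequences that are typical in this sense therefore have
asymptotically equal profiles (`IsTypical.tendsto_hausdorffEDist`), without any claim that the means
converge.

It remains to treat one deterministic typical sequence. Along an ultrafilter, the finite uniform
spaces have a limit that is a compact probability space, and the bounded matrices have a limit
operator `L² → L¹` on it. Their profiles converge to the profiles of that operator
(`exists_tendsto_hausdorffEDist_profile`). Convergence of the numbers `d_M` along the ultrafilter
yields an infinite set `S`, and the triangle inequality transfers the limit to the random matrices.
-/

/-! ### Lévy–Prokhorov bounds from couplings -/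

section Coupling

variable {X E : Type*} [MeasurableSpace X] [PseudoEMetricSpace E] [MeasurableSpace E]
  [OpensMeasurableSpace E]

/-- The easy half of Strassen's theorem: off the exceptional set, `f x ∈ B` puts `g x` in every
thickening of `B` of radius larger than `δ`. -/
theorem levyProkhorovEDist_map_le {μ : Measure X} {f g : X → E} (hf : AEMeasurable f μ)
    (hg : AEMeasurable g μ) {δ : ℝ≥0∞} (h : μ {x | δ < edist (f x) (g x)} ≤ δ) :
    levyProkhorovEDist (μ.map f) (μ.map g) ≤ δ := by
  have key : ∀ {f g : X → E}, AEMeasurable f μ → AEMeasurable g μ →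
      μ {x | δ < edist (f x) (g x)} ≤ δ → ∀ (ε : ℝ≥0∞) (B : Set E), δ < ε → ε < ∞ →
      MeasurableSet B → μ.map f B ≤ μ.map g (Metric.thickening ε.toReal B) + ε := by
    intro f g hf hg h ε B hδ hε hB
    rw [Measure.map_apply_of_aemeasurable hf hB,
      Measure.map_apply_of_aemeasurable hg Metric.isOpen_thickening.measurableSet]
    calc μ (f ⁻¹' B) ≤ μ (g ⁻¹' (Metric.thickening ε.toReal B) ∪ {x | δ < edist (f x) (g x)}) := by
          refine measure_mono fun x hx => ?_
          by_cases hx' : δ < edist (f x) (g x)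
          · exact Or.inr hx'
          · refine Or.inl ?_
            rw [Set.mem_preimage, Metric.mem_thickening_iff_exists_edist_lt]
            refine ⟨f x, hx, ?_⟩
            rw [ENNReal.ofReal_toReal hε.ne, edist_comm]
            exact (not_lt.1 hx').trans_lt hδ
      _ ≤ μ (g ⁻¹' (Metric.thickening ε.toReal B)) + μ {x | δ < edist (f x) (g x)} :=
          measure_union_le _ _
      _ ≤ _ := by gcongr; exact h.trans hδ.le
  refine levyProkhorovEDist_le_of_forall _ _ _ fun ε B hδ hε hB => ⟨?_, ?_⟩
  · exact key hf hg h ε B hδ hε hB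
  · refine key hg hf ?_ ε B hδ hε hB
    simpa only [edist_comm] using h

/-- Markov's inequality at level `δ` turns an `L¹` distance of `δ²` into an exceptional set of mass
at most `δ`. -/
theorem levyProkhorovEDist_map_le_of_lintegral_edist [SecondCountableTopology E] {μ : Measure X} {f g : X → E}
    (hf : AEMeasurable f μ) (hg : AEMeasurable g μ)
    {δ : ℝ≥0∞} (hδ : δ ≠ 0) (h : ∫⁻ x, edist (f x) (g x) ∂μ ≤ δ * δ) :
    levyProkhorovEDist (μ.map f) (μ.map g) ≤ δ := by
  rcases eq_or_ne δ ∞ with rfl | hδ'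
  · exact le_top
  refine levyProkhorovEDist_map_le hf hg ?_
  calc μ {x | δ < edist (f x) (g x)} ≤ (∫⁻ x, edist (f x) (g x) ∂μ) / δ := by
        refine (measure_mono fun x hx => ?_).trans
          (meas_ge_le_lintegral_div (hf.edist hg) hδ hδ')
        exact (show δ < edist (f x) (g x) from hx).le
    _ ≤ δ * δ / δ := by gcongr
    _ = δ := by rw [ENNReal.mul_div_cancel_right hδ hδ']

end Coupling

section Euclidean

variable {X κ : Type*} [MeasurableSpace X] [Fintype κ]

theorem EuclideanSpace.enorm_le_sum (x : EuclideanSpace ℝ κ) : ‖x‖ₑ ≤ ∑ c, ‖x c‖ₑ := by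
  classical
  calc ‖x‖ₑ = ‖∑ c, EuclideanSpace.single c (x c)‖ₑ := by
        congr 1
        ext d
        simp [Pi.single_apply]
    _ ≤ ∑ c, ‖EuclideanSpace.single c (x c)‖ₑ := enorm_sum_le _ _
    _ = ∑ c, ‖x c‖ₑ := by simp [enorm]

theorem levyProkhorovEDist_map_toLp_le {μ : Measure X} {f g : X → κ → ℝ}
    (hf : ∀ c, AEMeasurable (fun x => f x c) μ) (hg : ∀ c, AEMeasurable (fun x => g x c) μ)
    {δ : ℝ≥0∞} (hδ : δ ≠ 0) (h : ∑ c, ∫⁻ x, ‖f x c - g x c‖ₑ ∂μ ≤ δ * δ) :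
    levyProkhorovEDist (μ.map fun x => WithLp.toLp 2 (f x))
      (μ.map fun x => WithLp.toLp 2 (g x)) ≤ δ := by
  have hm : ∀ {f : X → κ → ℝ}, (∀ c, AEMeasurable (fun x => f x c) μ) →
      AEMeasurable (fun x => WithLp.toLp 2 (f x)) μ := fun {f} hf =>
    (WithLp.measurable_toLp 2 (κ → ℝ)).comp_aemeasurable (aemeasurable_pi_lambda _ hf)
  refine levyProkhorovEDist_map_le_of_lintegral_edist (hm hf) (hm hg) hδ (le_trans ?_ h)
  rw [← lintegral_finsetSum' (f := fun c x => ‖f x c - g x c‖ₑ) _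
    fun c _ => ((hf c).sub (hg c)).enorm]
  refine lintegral_mono fun x => ?_
  rw [edist_eq_enorm_sub]
  exact EuclideanSpace.enorm_le_sum _

end Euclidean

/-! ### Total boundedness from a first moment bound -/

/-- By Markov's inequality a common first moment bound gives tightness, with closed balls as the
compact sets. Prokhorov's theorem makes the closure compact, and the Lévy–Prokhorov metric induces
the weak topology. -/
theorem totallyBounded_setOf_lintegral_enorm_le {E : Type*} [NormedAddCommGroup E] [ProperSpace E]
    [MeasurableSpace E] [BorelSpace E] [SecondCountableTopology E] {C : ℝ≥0∞} (hC : C ≠ ∞) :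
    TotallyBounded {η : LevyProkhorov (ProbabilityMeasure E) |
      ∫⁻ x, ‖x‖ₑ ∂(η.toMeasure : Measure E) ≤ C} := by
  set S : Set (ProbabilityMeasure E) := {η | ∫⁻ x, ‖x‖ₑ ∂(η : Measure E) ≤ C}
  have hS : IsCompact (closure S) := by
    refine isCompact_closure_of_isTightMeasureSet ?_
    rw [isTightMeasureSet_iff_exists_isCompact_measure_compl_le]
    intro ε hε
    rcases eq_or_ne ε ∞ with rfl | hε'
    · exact ⟨∅, isCompact_empty, fun _ _ => le_top⟩
    refine ⟨Metric.closedBall 0 (C / ε).toReal, isCompact_closedBall _ _, ?_⟩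
    rintro _ ⟨η, hη, rfl⟩
    have hfin : C / ε ≠ ∞ := ENNReal.div_ne_top hC hε.ne'
    -- For `C = 0` the level `C / ε` is zero and Markov's inequality is not available; but then the
    -- measure sits at the origin.
    rcases eq_or_ne C 0 with h0 | h0
    · have : ∫⁻ x, ‖x‖ₑ ∂(η : Measure E) = 0 := le_antisymm (hη.trans h0.le) bot_le
      rw [lintegral_eq_zero_iff measurable_enorm] at this
      refine (measure_mono_null ?_ (ae_iff.1 this)).le.trans bot_le
      intro x hx hx'
      refine hx ?_
      simp at hx'
      simp [hx', h0]
    calc (η : Measure E) (Metric.closedBall 0 (C / ε).toReal)ᶜ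
        ≤ (η : Measure E) {x | C / ε ≤ ‖x‖ₑ} := by
          refine measure_mono fun x hx => ?_
          rw [Set.mem_compl_iff, mem_closedBall_zero_iff, not_le] at hx
          rw [Set.mem_ofPred_eq, ← ENNReal.ofReal_toReal hfin, ← ofReal_norm]
          exact ENNReal.ofReal_le_ofReal hx.le
      _ ≤ (∫⁻ x, ‖x‖ₑ ∂(η : Measure E)) / (C / ε) :=
          meas_ge_le_lintegral_div measurable_enorm.aemeasurable
            (ENNReal.div_pos h0 hε').ne' hfin
      _ ≤ C / (C / ε) := by gcongr; exact hη
      _ = ε := by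
          rw [ENNReal.div_eq_inv_mul, ENNReal.inv_div (.inl hε') (.inl hε.ne'),
            ENNReal.div_mul_cancel h0 hC]
  refine ((hS.image LevyProkhorov.probabilityMeasureHomeomorph.continuous).totallyBounded).subset ?_
  intro η hη
  exact ⟨η.toMeasure, subset_closure hη, rfl⟩

/-! ### Ultralimits of finite uniform spaces -/

theorem integrable_uniformFin {n : ℕ} {E : Type*} [NormedAddCommGroup E] (f : Fin n → E) :
    Integrable f (uniformFin n) := by
  rcases Nat.eq_zero_or_pos n with rfl | hn
  · rw [show uniformFin 0 = 0 from Measure.eq_zero_of_isEmpty _]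
    exact integrable_zero_measure
  · have : NeZero n := ⟨hn.ne'⟩
    exact Integrable.of_finite

theorem integral_uniformFin {n : ℕ} [NeZero n] (f : Fin n → ℝ) :
    ∫ j, f j ∂uniformFin n = (n : ℝ)⁻¹ * ∑ j, f j := by
  rw [integral_fintype (integrable_uniformFin f)]
  simp [uniformOn_univ, Measure.real, Finset.mul_sum]

/-- A compact probability space on which bounded sequences of functions on the finite uniform
probability spaces `Fin (n i)` become continuous functions, whose integral is the limit along `U`
of the averages. -/
structure UltraLimit {ι : Type} (n : ι → ℕ) (U : Filter ι) where
  /-- The underlying compact Hausdorff space. -/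
  Space : Type
  [top : TopologicalSpace Space]
  [compact : CompactSpace Space]
  [t2 : T2Space Space]
  [meas : MeasurableSpace Space]
  [borel : BorelSpace Space]
  /-- The limiting measure. -/
  measure : Measure Space
  [isProb : IsProbabilityMeasure measure]
  [regular : measure.Regular]
  /-- The image of the finite spaces. -/
  pt : ∀ i, Fin (n i) → Space
  tendsto_integral : ∀ F : C(Space, ℝ), Tendsto (fun i => ∫ j, F (pt i j) ∂uniformFin (n i)) U
    (𝓝 (∫ x, F x ∂measure))
  exists_extend : ∀ (f : ∀ i, Fin (n i) → ℝ) (a : ℝ), 0 ≤ a → (∀ i j, |f i j| ≤ a) →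
    ∃ F : C(Space, ℝ), (∀ i j, F (pt i j) = f i j) ∧ ∀ x, |F x| ≤ a

attribute [instance] UltraLimit.top UltraLimit.compact UltraLimit.t2 UltraLimit.meas
  UltraLimit.borel UltraLimit.isProb UltraLimit.regular

/-- The space is the Stone–Čech compactification of the disjoint union of the `Fin (n i)`, realised
as ultrafilters, so bounded functions extend by its universal property. The measure is the limit
along `U` of the pushed-forward uniform measures, which exists by compactness. -/
theorem UltraLimit.nonempty {ι : Type} (n : ι → ℕ) [∀ i, NeZero (n i)] (U : Ultrafilter ι) :
    Nonempty (UltraLimit n (U : Filter ι)) := by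
  let _ : MeasurableSpace (Ultrafilter (Σ i, Fin (n i))) := _root_.borel _
  have : BorelSpace (Ultrafilter (Σ i, Fin (n i))) := ⟨rfl⟩
  set pt : ∀ i, Fin (n i) → Ultrafilter (Σ i, Fin (n i)) := fun i j => pure ⟨i, j⟩
  have hpt : ∀ i, AEMeasurable (pt i) (uniformFin (n i)) := fun i =>
    (measurable_of_finite _).aemeasurable
  set emp : ι → ProbabilityMeasure (Ultrafilter (Σ i, Fin (n i))) := fun i =>
    ⟨(uniformFin (n i)).map (pt i), Measure.isProbabilityMeasure_map (hpt i)⟩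
  obtain ⟨μ, -, hμ⟩ := isCompact_univ.ultrafilter_le_nhds (U.map emp) (by simp)
  -- The space need not be metrizable, so regularity is not automatic. It is needed later for
  -- continuous functions to be dense in `L²`; passing to `ν` keeps all integrals of continuous
  -- functions.
  obtain ⟨ν, hν, hν', hνμ⟩ := Measure.exists_regular_eq_of_compactSpace
    (μ : Measure (Ultrafilter (Σ i, Fin (n i))))
  have hprob : IsProbabilityMeasure ν := by
    have := hνμ (BoundedContinuousFunction.const _ 1)
    simp only [BoundedContinuousFunction.const_apply, integral_const, smul_eq_mul, mul_one,
      probReal_univ] at this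
    exact isProbabilityMeasure_iff_real.2 this.symm
  refine ⟨{ Space := Ultrafilter (Σ i, Fin (n i)), measure := ν, pt := pt, tendsto_integral := ?_,
            exists_extend := ?_ }⟩
  · intro F
    have h1 : Tendsto emp U (𝓝 μ) := hμ
    have h2 := ProbabilityMeasure.tendsto_iff_forall_integral_tendsto.1 h1
      (BoundedContinuousFunction.mkOfCompact F)
    rw [hνμ] at h2
    refine h2.congr fun i => ?_
    exact integral_map (hpt i) F.continuous.aestronglyMeasurable
  · intro f a ha hf
    set g : (Σ i, Fin (n i)) → Set.Icc (-a) a := fun d => ⟨f d.1 d.2, abs_le.1 (hf d.1 d.2)⟩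
    refine ⟨⟨fun x => (Ultrafilter.extend g x : Set.Icc (-a) a).1,
      continuous_subtype_val.comp (continuous_ultrafilter_extend g)⟩, fun i j => ?_, fun x => ?_⟩
    · exact congrArg Subtype.val (ultrafilter_extend_pure g ⟨i, j⟩)
    · exact abs_le.2 (Ultrafilter.extend g x : Set.Icc (-a) a).2

namespace UltraLimit

variable {ι : Type} {n : ι → ℕ} {U : Ultrafilter ι}
  (L : UltraLimit n (U : Filter ι))

theorem norm_toLp_one (F : C(L.Space, ℝ)) :
    ‖ContinuousMap.toLp 1 L.measure ℝ F‖ = ∫ x, |F x| ∂L.measure := by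
  rw [L1.norm_eq_integral_norm]
  refine integral_congr_ae ?_
  filter_upwards [ContinuousMap.coeFn_toLp (p := 1) (𝕜 := ℝ) L.measure F] with x hx
  rw [hx, Real.norm_eq_abs]

theorem tendsto_integral_abs (F : C(L.Space, ℝ)) :
    Tendsto (fun i => ∫ j, |F (L.pt i j)| ∂uniformFin (n i)) U
      (𝓝 ‖ContinuousMap.toLp 1 L.measure ℝ F‖) := by
  rw [L.norm_toLp_one F]
  exact L.tendsto_integral ⟨fun x => |F x|, by fun_prop⟩

/-- `h` is the limit of the sequence `f` of functions on the finite spaces, in the sense of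
approximation by continuous functions in `L¹`. -/
def IsLimit (f : ∀ i, Fin (n i) → ℝ) (h : Lp ℝ 1 L.measure) : Prop :=
  ∀ ε > 0, ∃ F : C(L.Space, ℝ),
    (∀ᶠ i in (U : Filter ι), ∫ j, |f i j - F (L.pt i j)| ∂uniformFin (n i) ≤ ε) ∧
      ‖h - ContinuousMap.toLp 1 L.measure ℝ F‖ ≤ ε

variable {L}

theorem IsLimit.of_continuous (F : C(L.Space, ℝ)) :
    L.IsLimit (fun i j => F (L.pt i j)) (ContinuousMap.toLp 1 L.measure ℝ F) :=
  fun ε hε => ⟨F, by simp [hε.le], by simp [hε.le]⟩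

theorem IsLimit.add {f g : ∀ i, Fin (n i) → ℝ} {h k : Lp ℝ 1 L.measure} (hf : L.IsLimit f h)
    (hg : L.IsLimit g k) : L.IsLimit (fun i j => f i j + g i j) (h + k) := by
  intro ε hε
  obtain ⟨F, hF, hF'⟩ := hf (ε / 2) (half_pos hε)
  obtain ⟨G, hG, hG'⟩ := hg (ε / 2) (half_pos hε)
  refine ⟨F + G, ?_, ?_⟩
  · filter_upwards [hF, hG] with i h1 h2
    calc ∫ j, |f i j + g i j - (F + G) (L.pt i j)| ∂uniformFin (n i)
        ≤ ∫ j, (|f i j - F (L.pt i j)| + |g i j - G (L.pt i j)|) ∂uniformFin (n i) := by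
          refine integral_mono (integrable_uniformFin _) (integrable_uniformFin _) fun j => ?_
          have : f i j + g i j - (F + G) (L.pt i j) =
            (f i j - F (L.pt i j)) + (g i j - G (L.pt i j)) := by
            simp only [ContinuousMap.add_apply]; ring
          simp only [this]
          exact abs_add_le _ _
      _ ≤ ε := by
          rw [integral_add (integrable_uniformFin _) (integrable_uniformFin _)]
          linarith
  · rw [map_add, add_sub_add_comm]
    exact (norm_add_le _ _).trans (by linarith)

theorem IsLimit.smul {f : ∀ i, Fin (n i) → ℝ} {h : Lp ℝ 1 L.measure} (hf : L.IsLimit f h)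
    (c : ℝ) : L.IsLimit (fun i j => c * f i j) (c • h) := by
  intro ε hε
  have hc : 0 < |c| + 1 := by positivity
  obtain ⟨F, hF, hF'⟩ := hf (ε / (|c| + 1)) (div_pos hε hc)
  have key : ∀ x : ℝ, x ≤ ε / (|c| + 1) → |c| * x ≤ ε := by
    intro x hx
    calc |c| * x ≤ |c| * (ε / (|c| + 1)) := by gcongr
      _ ≤ (|c| + 1) * (ε / (|c| + 1)) := by gcongr; linarith
      _ = ε := by field_simp
  refine ⟨c • F, ?_, ?_⟩
  · filter_upwards [hF] with i h1
    calc ∫ j, |c * f i j - (c • F) (L.pt i j)| ∂uniformFin (n i)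
        = |c| * ∫ j, |f i j - F (L.pt i j)| ∂uniformFin (n i) := by
          rw [← integral_const_mul]
          refine integral_congr_ae (ae_of_all _ fun j => ?_)
          simp only [ContinuousMap.smul_apply, smul_eq_mul, ← mul_sub, abs_mul]
      _ ≤ ε := key _ h1
  · rw [map_smul, ← smul_sub, norm_smul, Real.norm_eq_abs]
    exact key _ hF'

theorem IsLimit.norm_le {f : ∀ i, Fin (n i) → ℝ} {h : Lp ℝ 1 L.measure} (hf : L.IsLimit f h)
    {c : ℝ} (hc : ∀ᶠ i in (U : Filter ι), ∫ j, |f i j| ∂uniformFin (n i) ≤ c) : ‖h‖ ≤ c := by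
  refine le_of_forall_pos_le_add fun ε hε => ?_
  obtain ⟨F, hF, hF'⟩ := hf (ε / 2) (half_pos hε)
  have h1 : ‖ContinuousMap.toLp 1 L.measure ℝ F‖ ≤ c + ε / 2 := by
    refine le_of_tendsto (L.tendsto_integral_abs F) ?_
    filter_upwards [hF, hc] with i h1 h2
    calc ∫ j, |F (L.pt i j)| ∂uniformFin (n i)
        ≤ ∫ j, (|f i j| + |f i j - F (L.pt i j)|) ∂uniformFin (n i) := by
          refine integral_mono (integrable_uniformFin _) (integrable_uniformFin _) fun j => ?_
          have := abs_sub_abs_le_abs_sub (F (L.pt i j)) (f i j)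
          rw [abs_sub_comm] at this
          simp only
          linarith
      _ ≤ c + ε / 2 := by
          rw [integral_add (integrable_uniformFin _) (integrable_uniformFin _)]
          linarith
  calc ‖h‖ = ‖(h - ContinuousMap.toLp 1 L.measure ℝ F) + ContinuousMap.toLp 1 L.measure ℝ F‖ := by
        rw [sub_add_cancel]
    _ ≤ ε / 2 + (c + ε / 2) := (norm_add_le _ _).trans (add_le_add hF' h1)
    _ = c + ε := by ring

theorem IsLimit.unique {f : ∀ i, Fin (n i) → ℝ} {h k : Lp ℝ 1 L.measure} (hf : L.IsLimit f h)
    (hk : L.IsLimit f k) : h = k := by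
  have := (hf.add (hk.smul (-1))).norm_le (c := 0) (by simp)
  rw [norm_le_zero_iff] at this
  simpa [sub_eq_zero, ← sub_eq_add_neg] using this

/-- Truncating at height `m + 1` costs at most `C / (m + 1)` in `L¹`, uniformly in `i`. The
truncations are bounded, so they extend to continuous functions on the limit space; these are Cauchy
in `L¹`, and their limit is `h`. -/
theorem exists_isLimit_of_integral_sq_le {f : ∀ i, Fin (n i) → ℝ} {C : ℝ}
    (hC : ∀ i, ∫ j, f i j ^ 2 ∂uniformFin (n i) ≤ C) : ∃ h, L.IsLimit f h := by
  set T : ℕ → ∀ i, Fin (n i) → ℝ := fun m i j => max (-(m + 1 : ℝ)) (min (m + 1) (f i j))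
  have hT : ∀ m i j, |T m i j| ≤ m + 1 := fun m i j =>
    abs_le.2 ⟨le_max_left _ _, max_le (by linarith [m.cast_nonneg (α := ℝ)]) (min_le_left _ _)⟩
  have hTf : ∀ m i, ∫ j, |f i j - T m i j| ∂uniformFin (n i) ≤ C / (m + 1) := by
    intro m i
    have hm : (0 : ℝ) < m + 1 := by positivity
    calc ∫ j, |f i j - T m i j| ∂uniformFin (n i)
        -- The integrand on the left vanishes unless `|f|` exceeds `m + 1`, where it is at most `|f|
        -- ≤ f² / (m + 1)`.
        ≤ ∫ j, f i j ^ 2 / (m + 1) ∂uniformFin (n i) := by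
          refine integral_mono (integrable_uniformFin _) (integrable_uniformFin _) fun j => ?_
          simp only [T]
          rw [le_div_iff₀ hm]
          rcases le_total (f i j) (-(m + 1)) with h1 | h1
          · rw [min_eq_right (by linarith), max_eq_left h1, abs_of_nonpos (by linarith)]
            nlinarith
          · rcases le_total (f i j) (m + 1) with h2 | h2
            · rw [min_eq_right h2, max_eq_right h1, sub_self, abs_zero, zero_mul]
              positivity
            · rw [min_eq_left h2, max_eq_right (by linarith), abs_of_nonneg (by linarith)]
              nlinarith
      _ ≤ C / (m + 1) := by
          rw [integral_div]
          gcongr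
          exact hC i
  choose F hF hF' using fun m : ℕ => L.exists_extend (T m) (m + 1) (by positivity) (hT m)
  have hlim : Tendsto (fun m : ℕ => C / ((m : ℝ) + 1)) atTop (𝓝 0) :=
    tendsto_const_div_atTop_nhds_zero_nat C |>.comp (tendsto_add_atTop_nat 1) |>.congr fun m => by
      simp
  have hd : ∀ m m', ‖ContinuousMap.toLp 1 L.measure ℝ (F m) -
      ContinuousMap.toLp 1 L.measure ℝ (F m')‖ ≤ C / (m + 1) + C / (m' + 1) := by
    intro m m'
    rw [← map_sub]
    refine le_of_tendsto (L.tendsto_integral_abs _) (Eventually.of_forall fun i => ?_)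
    calc ∫ j, |(F m - F m') (L.pt i j)| ∂uniformFin (n i)
        ≤ ∫ j, (|f i j - T m i j| + |f i j - T m' i j|) ∂uniformFin (n i) := by
          refine integral_mono (integrable_uniformFin _) (integrable_uniformFin _) fun j => ?_
          simp only [ContinuousMap.sub_apply, hF]
          rw [abs_sub_comm (f i j) (T m i j)]
          exact abs_sub_le _ _ _
      _ ≤ _ := by
          rw [integral_add (integrable_uniformFin _) (integrable_uniformFin _)]
          exact add_le_add (hTf m i) (hTf m' i)
  have hcau : CauchySeq fun m => ContinuousMap.toLp 1 L.measure ℝ (F m) := by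
    refine Metric.cauchySeq_iff'.2 fun ε hε => ?_
    obtain ⟨N, hN⟩ := eventually_atTop.1 ((tendsto_order.1 hlim).2 (ε / 2) (half_pos hε))
    refine ⟨N, fun m hm => ?_⟩
    rw [dist_eq_norm]
    exact (hd m N).trans_lt (by linarith [hN m hm, hN N le_rfl])
  obtain ⟨h, hh⟩ := cauchySeq_tendsto_of_complete hcau
  refine ⟨h, fun ε hε => ?_⟩
  have h2 : ∀ᶠ m in atTop, ‖h - ContinuousMap.toLp 1 L.measure ℝ (F m)‖ < ε := by
    have := (tendsto_const_nhds (x := h)).sub hh |>.norm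
    rw [sub_self, norm_zero] at this
    exact (tendsto_order.1 this).2 ε hε
  obtain ⟨m, hm, hm'⟩ := (((tendsto_order.1 hlim).2 ε hε).and h2).exists
  refine ⟨F m, Eventually.of_forall fun i => ?_, hm'.le⟩
  simp only [hF]
  exact (hTf m i).trans hm.le

theorem lintegral_enorm_sub_toLp (h : Lp ℝ 1 L.measure) (F : C(L.Space, ℝ)) :
    ∫⁻ x, ‖h x - F x‖ₑ ∂L.measure =
      ENNReal.ofReal ‖h - ContinuousMap.toLp 1 L.measure ℝ F‖ := by
  rw [ofReal_norm, Lp.enorm_def, eLpNorm_one_eq_lintegral_enorm]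
  refine lintegral_congr_ae ?_
  filter_upwards [ContinuousMap.coeFn_toLp (p := 1) (𝕜 := ℝ) L.measure F,
    Lp.coeFn_sub h (ContinuousMap.toLp 1 L.measure ℝ F)] with x h1 h2
  rw [h2, Pi.sub_apply, h1]

/-- For a bounded continuous test function `G`, the composite `G ∘ F` is continuous on the limit
space, so the laws converge weakly; the metric follows by separability. -/
theorem tendsto_levyProkhorovEDist_of_continuous [∀ i, NeZero (n i)] {E : Type*}
    [PseudoMetricSpace E] [SecondCountableTopology E] [MeasurableSpace E] [BorelSpace E]
    (F : C(L.Space, E)) :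
    Tendsto (fun i => levyProkhorovEDist ((uniformFin (n i)).map fun j => F (L.pt i j))
      (L.measure.map F)) U (𝓝 0) := by
  have hm : ∀ i, AEMeasurable (fun j => F (L.pt i j)) (uniformFin (n i)) := fun i =>
    (measurable_of_finite _).aemeasurable
  have hF : AEMeasurable F L.measure := F.continuous.measurable.aemeasurable
  set law : ι → ProbabilityMeasure E := fun i =>
    ⟨(uniformFin (n i)).map fun j => F (L.pt i j), Measure.isProbabilityMeasure_map (hm i)⟩
  set lim : ProbabilityMeasure E := ⟨L.measure.map F, Measure.isProbabilityMeasure_map hF⟩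
  have h1 : Tendsto law U (𝓝 lim) := by
    rw [ProbabilityMeasure.tendsto_iff_forall_integral_tendsto]
    intro G
    have h2 := L.tendsto_integral ⟨fun x => G (F x), by fun_prop⟩
    have h3 : ∫ x, G x ∂(lim : Measure E) = ∫ x, G (F x) ∂L.measure :=
      integral_map hF G.continuous.aestronglyMeasurable
    rw [h3]
    refine h2.congr fun i => ?_
    exact (integral_map (hm i) G.continuous.aestronglyMeasurable).symm
  have h4 := (LevyProkhorov.continuous_ofMeasure_probabilityMeasure 
    (Ω := E)).continuousAt.tendsto.comp h1
  exact tendsto_iff_edist_tendsto_0.1 h4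

theorem IsLimit.tendsto_levyProkhorovEDist [∀ i, NeZero (n i)] {κ : Type*} [Fintype κ]
    {f : κ → ∀ i, Fin (n i) → ℝ}
    {h : κ → Lp ℝ 1 L.measure} (hf : ∀ c, L.IsLimit (f c) (h c)) :
    Tendsto (fun i => levyProkhorovEDist
      ((uniformFin (n i)).map fun j => WithLp.toLp 2 fun c => f c i j)
      (L.measure.map fun x => WithLp.toLp 2 fun c => h c x)) U (𝓝 0) := by
  rw [ENNReal.tendsto_nhds_zero]
  intro ε hε
  obtain ⟨δ, hδ, hδε⟩ := ENNReal.lt_iff_exists_nnreal_btwn.1 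
    (ENNReal.div_pos hε.ne' (by simp : (3 : ℝ≥0∞) ≠ ∞))
  have hδ0 : (0 : ℝ) < δ := by simpa using hδ
  -- The coordinate errors must add up to at most `δ²` for the coupling bound; the `+ 1` covers an
  -- empty `κ`.
  have hη : (0 : ℝ) < δ * δ / (Fintype.card κ + 1) := by positivity
  choose F hF hF' using fun c => hf c _ hη
  have hsum : ∀ a : κ → ℝ≥0∞, (∀ c, a c ≤ ENNReal.ofReal (δ * δ / (Fintype.card κ + 1))) →
      ∑ c, a c ≤ (δ : ℝ≥0∞) * δ := by
    intro a ha
    calc ∑ c, a c ≤ ∑ _c : κ, ENNReal.ofReal (δ * δ / (Fintype.card κ + 1)) :=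
          Finset.sum_le_sum fun c _ => ha c
      _ = ENNReal.ofReal (Fintype.card κ * (δ * δ / (Fintype.card κ + 1))) := by
          rw [Finset.sum_const, Finset.card_univ, nsmul_eq_mul,
            ENNReal.ofReal_mul (Nat.cast_nonneg _), ENNReal.ofReal_natCast]
      _ ≤ ENNReal.ofReal (δ * δ) := by
          refine ENNReal.ofReal_le_ofReal ?_
          rw [mul_div_assoc', div_le_iff₀ (by positivity)]
          nlinarith [mul_pos hδ0 hδ0]
      _ = δ * δ := by rw [ENNReal.ofReal_mul hδ0.le, ENNReal.ofReal_coe_nnreal]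
  have hlim := tendsto_levyProkhorovEDist_of_continuous (L := L)
    (E := EuclideanSpace ℝ κ) ⟨fun x => WithLp.toLp 2 fun c => F c x, by fun_prop⟩
  have hlast : levyProkhorovEDist (L.measure.map fun x => WithLp.toLp 2 fun c => F c x)
      (L.measure.map fun x => WithLp.toLp 2 fun c => h c x) ≤ δ := by
    rw [levyProkhorovEDist_comm]
    refine levyProkhorovEDist_map_toLp_le (fun c => (Lp.aestronglyMeasurable (h c)).aemeasurable)
      (fun c => (F c).continuous.measurable.aemeasurable) (by simpa using hδ.ne')
      (hsum _ fun c => ?_)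
    rw [lintegral_enorm_sub_toLp]
    exact ENNReal.ofReal_le_ofReal (hF' c)
  filter_upwards [ENNReal.tendsto_nhds_zero.1 hlim δ hδ, eventually_all.2 hF] with i h1 h2
  have hfirst : levyProkhorovEDist ((uniformFin (n i)).map fun j => WithLp.toLp 2 fun c => f c i j)
      ((uniformFin (n i)).map fun j => WithLp.toLp 2 fun c => F c (L.pt i j)) ≤ δ := by
    refine levyProkhorovEDist_map_toLp_le (fun c => (measurable_of_finite _).aemeasurable)
      (fun c => (measurable_of_finite _).aemeasurable) (by simpa using hδ.ne')
      (hsum _ fun c => ?_)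
    rw [← ofReal_integral_norm_eq_lintegral_enorm (integrable_uniformFin _)]
    exact ENNReal.ofReal_le_ofReal (h2 c)
  calc _ ≤ δ + (δ + δ : ℝ≥0∞) :=
        (levyProkhorovEDist_triangle _ _ _).trans (add_le_add hfirst
          ((levyProkhorovEDist_triangle _ _ _).trans (add_le_add h1 hlast)))
    _ = 3 * δ := by ring
    _ ≤ 3 * (ε / 3) := by gcongr
    _ ≤ ε := ENNReal.mul_div_le

end UltraLimit

/-! ### Row-bounded matrices and compactness of their profiles -/

open scoped Matrix

/-- The inclusion of `L^∞` into `L²` on a probability space. -/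
noncomputable def MeasureTheory.Lp.topToTwo {X : Type*} [MeasurableSpace X] (μ : Measure X)
    [IsProbabilityMeasure μ] : Lp ℝ ∞ μ →L[ℝ] Lp ℝ 2 μ :=
  LinearMap.mkContinuous
    { toFun := fun v => ⟨v.1, Lp.antitone le_top v.2⟩
      map_add' := fun _ _ => rfl
      map_smul' := fun _ _ => rfl } 1 fun v => by
    rw [one_mul, Lp.norm_def, Lp.norm_def]
    exact ENNReal.toReal_mono (Lp.eLpNorm_ne_top v)
      (eLpNorm_le_eLpNorm_of_exponent_le le_top (Lp.aestronglyMeasurable v))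

theorem MeasureTheory.Lp.topToTwo_apply {X : Type*} [MeasurableSpace X] (μ : Measure X)
    [IsProbabilityMeasure μ] (v : Lp ℝ ∞ μ) (x : X) : Lp.topToTwo μ v x = v x := rfl

namespace Matrix

/-- Bounds on the row action of a matrix `H`, with respect to the uniform probability measure: as a
map from `L^∞` to `L²` and as a map from `L²` to `L¹` it has norm at most `C`. -/
structure IsRowBounded {n : ℕ} (C : ℝ) (H : Matrix (Fin n) (Fin n) ℝ) : Prop where
  sq_le : ∀ v : Fin n → ℝ, (∀ j, |v j| ≤ 1) → ∫ j, (v ᵥ* H) j ^ 2 ∂uniformFin n ≤ C ^ 2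
  abs_le : ∀ v : Fin n → ℝ, ∫ j, |(v ᵥ* H) j| ∂uniformFin n ≤
    C * Real.sqrt (∫ j, v j ^ 2 ∂uniformFin n)

theorem IsRowBounded.sq_le_of_abs_le {n : ℕ} {C : ℝ} {H : Matrix (Fin n) (Fin n) ℝ}
    (hH : H.IsRowBounded C) {a : ℝ} (ha : 0 < a) {v : Fin n → ℝ} (hv : ∀ j, |v j| ≤ a) :
    ∫ j, (v ᵥ* H) j ^ 2 ∂uniformFin n ≤ (a * C) ^ 2 := by
  have h := hH.sq_le (a⁻¹ • v) fun j => by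
    rw [Pi.smul_apply, smul_eq_mul, abs_mul, abs_of_pos (inv_pos.2 ha), inv_mul_le_iff₀ ha, mul_one]
    exact hv j
  simp only [Matrix.smul_vecMul, Pi.smul_apply, smul_eq_mul, mul_pow, integral_const_mul,
    inv_pow] at h
  rw [inv_mul_le_iff₀ (by positivity)] at h
  rwa [mul_pow]

/-- A vector as an element of `L^∞`. -/
noncomputable def toLpTop {n : ℕ} (v : Fin n → ℝ) : Lp ℝ ∞ (uniformFin n) :=
  MemLp.toLp v (by
    rcases Nat.eq_zero_or_pos n with rfl | hn
    · rw [show uniformFin 0 = 0 from Measure.eq_zero_of_isEmpty _]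
      simp
    · have : NeZero n := ⟨hn.ne'⟩
      exact MemLp.of_discrete)

theorem coeFn_toLpTop {n : ℕ} (v : Fin n → ℝ) : ⇑(toLpTop v) = v :=
  funext (forall_of_ae_uniformFin (MemLp.coeFn_toLp _))

theorem jointMap_toLpTop {n k : ℕ} [NeZero n] (H : Matrix (Fin n) (Fin n) ℝ)
    (v : Fin k → Fin n → ℝ) (j : Fin n) :
    H.toPOperator.jointMap (fun c => toLpTop (v c)) j =
      WithLp.toLp 2 (Sum.elim (fun c => v c j) (fun c => (v c ᵥ* H) j)) := by
  have h1 : ∀ c, (toLpTop (v c) : Fin n → ℝ) j = v c j := fun c => by rw [coeFn_toLpTop]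
  have h2 : ∀ c, (H.rowAction (toLpTop (v c)) : Fin n → ℝ) j = (v c ᵥ* H) j := fun c => by
    rw [rowAction_apply, coeFn_toLpTop]
    rfl
  unfold POperator.jointMap
  congr 1
  ext (c | c)
  · exact h1 c
  · exact h2 c

/-- Every point of `[n]` has positive mass, so almost-everywhere classes are plain vectors and the
bound holds at every point. -/
theorem mem_profile_toPOperator {n k : ℕ} [NeZero n] {H : Matrix (Fin n) (Fin n) ℝ}
    {η : LevyProkhorov (ProbabilityMeasure (POperator.ProfileSpace k))} :
    η ∈ H.toPOperator.profile k ↔ ∃ v : Fin k → Fin n → ℝ, (∀ c j, |v c j| ≤ 1) ∧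
      η = H.toPOperator.jointLaw (fun c => toLpTop (v c)) := by
  constructor
  · rintro ⟨v, hv, rfl⟩
    refine ⟨fun c => v c, fun c j => abs_le.2 (forall_of_ae_uniformFin (hv c) j), ?_⟩
    congr 1
    ext c : 1
    exact Lp.ext (ae_of_all _ (congrFun (coeFn_toLpTop (n := n) (v c)).symm))
  · rintro ⟨v, hv, rfl⟩
    refine ⟨_, fun c => ?_, rfl⟩
    refine ae_of_all _ fun j => ?_
    have : (toLpTop (v c) : Fin n → ℝ) j ∈ Set.Icc (-1 : ℝ) 1 := by
      rw [coeFn_toLpTop]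
      exact abs_le.1 (hv c j)
    exact this

end Matrix

namespace POperator

theorem edist_jointLaw (A B : POperator) {k : ℕ} (v : Fin k → Lp ℝ ∞ A.measure)
    (w : Fin k → Lp ℝ ∞ B.measure) : edist (A.jointLaw v) (B.jointLaw w) =
      levyProkhorovEDist (A.measure.map (A.jointMap v)) (B.measure.map (B.jointMap w)) := rfl

theorem lintegral_enorm_jointLaw_le (A : POperator) {k : ℕ} {v : Fin k → Lp ℝ ∞ A.measure}
    (hv : ∀ c, ∀ᵐ x ∂A.measure, v c x ∈ Set.Icc (-1 : ℝ) 1) {C : ℝ≥0∞}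
    (hC : ∀ c, ‖A.op (v c)‖ₑ ≤ C) :
    ∫⁻ x, ‖x‖ₑ ∂((A.jointLaw v).toMeasure : Measure (ProfileSpace k)) ≤ k * (1 + C) := by
  have h1 : ∫⁻ x, ‖x‖ₑ ∂((A.jointLaw v).toMeasure : Measure (ProfileSpace k)) =
      ∫⁻ x, ‖A.jointMap v x‖ₑ ∂A.measure :=
    lintegral_map' measurable_enorm.aemeasurable (A.aemeasurable_jointMap v)
  rw [h1]
  calc ∫⁻ x, ‖A.jointMap v x‖ₑ ∂A.measure
      ≤ ∫⁻ x, ∑ c, (‖v c x‖ₑ + ‖A.op (v c) x‖ₑ) ∂A.measure := by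
        refine lintegral_mono fun x => (EuclideanSpace.enorm_le_sum _).trans ?_
        rw [Fintype.sum_sum_type, Finset.sum_add_distrib]
        rfl
    _ = ∑ c, ∫⁻ x, (‖v c x‖ₑ + ‖A.op (v c) x‖ₑ) ∂A.measure :=
        lintegral_finsetSum' _ fun c _ => (Lp.aestronglyMeasurable _).enorm.add
          (Lp.aestronglyMeasurable _).enorm
    _ ≤ ∑ _c : Fin k, (1 + C) := by
        refine Finset.sum_le_sum fun c _ => ?_
        rw [lintegral_add_left' (Lp.aestronglyMeasurable _).enorm]
        refine add_le_add ?_ ?_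
        · calc ∫⁻ x, ‖v c x‖ₑ ∂A.measure ≤ ∫⁻ _x, 1 ∂A.measure := by
                refine lintegral_mono_ae ?_
                filter_upwards [hv c] with x hx
                rw [Real.enorm_eq_ofReal_abs]
                exact ENNReal.ofReal_le_one.2 (abs_le.2 hx)
            _ = 1 := by simp
        · rw [← eLpNorm_one_eq_lintegral_enorm, ← Lp.enorm_def]
          exact hC c
    _ = k * (1 + C) := by simp [mul_add]

theorem totallyBounded_profile (A : POperator) (k : ℕ) : TotallyBounded (A.profile k) := by
  refine (totallyBounded_setOf_lintegral_enorm_le (E := ProfileSpace k)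
    (C := k * (1 + ‖A.op‖ₑ)) (by finiteness)).subset ?_
  rintro _ ⟨v, hv, rfl⟩
  refine A.lintegral_enorm_jointLaw_le hv fun c => ?_
  have h1 : ‖v c‖ ≤ 1 := by
    refine (Lp.norm_le_of_ae_bound zero_le_one ?_).trans_eq (by simp [measureUnivNNReal])
    filter_upwards [hv c] with x hx
    exact abs_le.2 hx
  rw [← ofReal_norm, ← ofReal_norm]
  exact ENNReal.ofReal_le_ofReal ((A.op.le_opNorm _).trans
    (mul_le_of_le_one_right (norm_nonneg _) h1))

/-- The moment bound `k (1 + |C|)` does not involve `n`, so one finite net serves matrices of all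
sizes. -/
theorem totallyBounded_iUnion_profile (C : ℝ) (k : ℕ) :
    TotallyBounded {η | ∃ (n : ℕ) (_ : NeZero n) (H : Matrix (Fin n) (Fin n) ℝ),
      H.IsRowBounded C ∧ η ∈ H.toPOperator.profile k} := by
  refine (totallyBounded_setOf_lintegral_enorm_le (E := ProfileSpace k)
    (C := k * (1 + ENNReal.ofReal |C|)) (by finiteness)).subset ?_
  rintro η ⟨n, _, H, hH, hη⟩
  obtain ⟨v, hv, rfl⟩ := Matrix.mem_profile_toPOperator.1 hη
  refine H.toPOperator.lintegral_enorm_jointLaw_le (fun c => ?_) fun c => ?_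
  · refine ae_of_all _ fun j => ?_
    have : (Matrix.toLpTop (v c) : Fin n → ℝ) j ∈ Set.Icc (-1 : ℝ) 1 := by
      rw [Matrix.coeFn_toLpTop]
      exact abs_le.1 (hv c j)
    exact this
  rw [← ofReal_norm]
  refine ENNReal.ofReal_le_ofReal ?_
  rw [L1.norm_eq_integral_norm]
  calc ∫ j : Fin n, ‖(H.rowAction (Matrix.toLpTop (v c)) : Fin n → ℝ) j‖ ∂uniformFin n
      = ∫ j, |(v c ᵥ* H) j| ∂uniformFin n := by
        refine integral_congr_ae (ae_of_all _ fun j => ?_)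
        refine congrArg (|·|) ((Matrix.rowAction_apply H _ j).trans ?_)
        rw [Matrix.coeFn_toLpTop]
        rfl
    _ ≤ C * Real.sqrt (∫ j, v c j ^ 2 ∂uniformFin n) := hH.abs_le _
    _ ≤ |C| * 1 := by
        refine mul_le_mul (le_abs_self C) ?_ (Real.sqrt_nonneg _) (abs_nonneg _)
        rw [Real.sqrt_le_one]
        calc ∫ j, v c j ^ 2 ∂uniformFin n ≤ ∫ _j, 1 ∂uniformFin n := by
              refine integral_mono (integrable_uniformFin _) (integrable_uniformFin _) fun j => ?_
              exact (sq_le_one_iff_abs_le_one _).2 (hv c j)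
          _ = 1 := by simp
    _ = |C| := mul_one _

end POperator

/-! ### The limit operator and convergence of profiles -/

namespace UltraLimit

variable {ι : Type} {n : ι → ℕ} {U : Ultrafilter ι} (L : UltraLimit n (U : Filter ι))

theorem norm_toLp_two_sq (F : C(L.Space, ℝ)) :
    ‖ContinuousMap.toLp 2 L.measure ℝ F‖ ^ 2 = ∫ x, F x ^ 2 ∂L.measure := by
  rw [← real_inner_self_eq_norm_sq, L2.inner_def]
  refine integral_congr_ae ?_
  filter_upwards [ContinuousMap.coeFn_toLp (p := 2) (𝕜 := ℝ) L.measure F] with x hx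
  rw [hx, real_inner_self_eq_norm_sq, Real.norm_eq_abs, sq_abs]

/-- The `L^∞ → L²` bound provides a limit for each continuous `F`, and uniqueness of limits makes it
linear in `F`. The `L² → L¹` bound survives in the limit and allows extension by density. Density is
why `L²` appears: continuous functions need not be dense in `L^∞`. -/
theorem exists_limit_operator [∀ i, NeZero (n i)] {C : ℝ}
    {H : ∀ i, Matrix (Fin (n i)) (Fin (n i)) ℝ} (hH : ∀ i, (H i).IsRowBounded C) :
    ∃ A : Lp ℝ 2 L.measure →L[ℝ] Lp ℝ 1 L.measure, ∀ F : C(L.Space, ℝ),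
      L.IsLimit (fun i => (fun j => F (L.pt i j)) ᵥ* H i)
        (A (ContinuousMap.toLp 2 L.measure ℝ F)) := by
  have hex : ∀ F : C(L.Space, ℝ), ∃ h, L.IsLimit (fun i => (fun j => F (L.pt i j)) ᵥ* H i) h := by
    intro F
    -- The `+ 1` keeps the rescaling factor positive when `F = 0`.
    refine exists_isLimit_of_integral_sq_le (C := ((‖F‖ + 1) * C) ^ 2) fun i => ?_
    refine (hH i).sq_le_of_abs_le (by positivity) fun j => ?_
    exact (F.norm_coe_le_norm _).trans (by linarith)
  choose a ha using hex
  let a' : C(L.Space, ℝ) →ₗ[ℝ] Lp ℝ 1 L.measure :=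
    { toFun := a
      map_add' := fun F G => by
        refine (ha (F + G)).unique ?_
        have := (ha F).add (ha G)
        convert! this using 3 with i j
        exact congrFun (Matrix.add_vecMul (H i) (fun j => F (L.pt i j)) fun j => G (L.pt i j)) j
      map_smul' := fun c F => by
        refine (ha (c • F)).unique ?_
        have := (ha F).smul c
        convert! this using 3 with i j
        exact congrFun (Matrix.smul_vecMul c (fun j => F (L.pt i j)) (H i)) j }
  have hnorm : ∀ F, ‖a' F‖ ≤ C * ‖(ContinuousMap.toLp 2 L.measure ℝ).toLinearMap F‖ := by
    intro F
    refine le_of_forall_pos_le_add fun ε hε => ?_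
    have h1 : Tendsto (fun i => C * Real.sqrt (∫ j, F (L.pt i j) ^ 2 ∂uniformFin (n i))) U
        (𝓝 (C * ‖ContinuousMap.toLp 2 L.measure ℝ F‖)) := by
      have h2 := L.tendsto_integral ⟨fun x => F x ^ 2, by fun_prop⟩
      have h3 := (Real.continuous_sqrt.continuousAt.tendsto.comp h2).const_mul C
      simp only [ContinuousMap.coe_mk] at h3
      rw [← L.norm_toLp_two_sq, Real.sqrt_sq (norm_nonneg _)] at h3
      exact h3
    refine (ha F).norm_le ?_
    filter_upwards [(tendsto_order.1 h1).2 (C * ‖ContinuousMap.toLp 2 L.measure ℝ F‖ + ε)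
      (by linarith)] with i hi
    exact ((hH i).abs_le _).trans hi.le
  have hdense : DenseRange
      (ContinuousMap.toLp 2 L.measure ℝ : C(L.Space, ℝ) →L[ℝ] Lp ℝ 2 L.measure).toLinearMap :=
    ContinuousMap.toLp_denseRange ℝ L.measure ℝ (by simp)
  refine ⟨a'.extendOfNorm (ContinuousMap.toLp 2 L.measure ℝ).toLinearMap, fun F => ?_⟩
  have := LinearMap.extendOfNorm_eq hdense ⟨C, hnorm⟩ F
  rw [ContinuousLinearMap.coe_coe] at this
  rw [this]
  exact ha F

/-- The `P`-operator given by an operator `L² → L¹` on the limiting space. -/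
noncomputable def toPOperator (A : Lp ℝ 2 L.measure →L[ℝ] Lp ℝ 1 L.measure) : POperator where
  Space := L.Space
  mSpace := inferInstance
  measure := L.measure
  isProb := inferInstance
  op := A ∘L Lp.topToTwo L.measure

theorem topToTwo_toLp (F : C(L.Space, ℝ)) :
    Lp.topToTwo L.measure (ContinuousMap.toLp ∞ L.measure ℝ F) =
      ContinuousMap.toLp 2 L.measure ℝ F := by
  refine Lp.ext ?_
  filter_upwards [ContinuousMap.coeFn_toLp (p := 2) (𝕜 := ℝ) L.measure F,
    ContinuousMap.coeFn_toLp (p := ∞) (𝕜 := ℝ) L.measure F] with x h1 h2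
  rw [h1, Lp.topToTwo_apply, h2]

variable {L}

theorem tendsto_edist_jointLaw [∀ i, NeZero (n i)]
    {H : ∀ i, Matrix (Fin (n i)) (Fin (n i)) ℝ}
    {A : Lp ℝ 2 L.measure →L[ℝ] Lp ℝ 1 L.measure} (hA : ∀ F : C(L.Space, ℝ),
      L.IsLimit (fun i => (fun j => F (L.pt i j)) ᵥ* H i)
        (A (ContinuousMap.toLp 2 L.measure ℝ F))) {k : ℕ} (F : Fin k → C(L.Space, ℝ)) :
    Tendsto (fun i => edist
      ((H i).toPOperator.jointLaw fun c => Matrix.toLpTop fun j => F c (L.pt i j))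
      ((L.toPOperator A).jointLaw fun c => ContinuousMap.toLp ∞ L.measure ℝ (F c))) U (𝓝 0) := by
  have h := IsLimit.tendsto_levyProkhorovEDist (L := L) (κ := Fin k ⊕ Fin k)
    (f := Sum.elim (fun c i j => F c (L.pt i j))
      (fun c i => (fun j => F c (L.pt i j)) ᵥ* H i))
    (h := Sum.elim (fun c => ContinuousMap.toLp 1 L.measure ℝ (F c))
      (fun c => A (ContinuousMap.toLp 2 L.measure ℝ (F c)))) (by
        rintro (c | c)
        · exact IsLimit.of_continuous (F c)
        · exact hA (F c))
  refine h.congr fun i => ?_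
  refine Eq.trans ?_ (POperator.edist_jointLaw (H i).toPOperator (L.toPOperator A) _ _).symm
  have e1 : ((uniformFin (n i)).map fun j => WithLp.toLp 2 fun c =>
      (Sum.elim (fun c i j => F c (L.pt i j)) (fun c i => (fun j => F c (L.pt i j)) ᵥ* H i) :
        Fin k ⊕ Fin k → ∀ i, Fin (n i) → ℝ) c i j) =
      (H i).toPOperator.measure.map ((H i).toPOperator.jointMap
        fun c => Matrix.toLpTop fun j => F c (L.pt i j)) := by
    congr 1
    funext j
    refine Eq.trans ?_ (Matrix.jointMap_toLpTop (H i) _ j).symm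
    congr 1
    ext (c | c) <;> rfl
  have e2 : (L.measure.map fun x => WithLp.toLp 2 fun c =>
      (Sum.elim (fun c => ContinuousMap.toLp 1 L.measure ℝ (F c))
        (fun c => A (ContinuousMap.toLp 2 L.measure ℝ (F c))) :
        Fin k ⊕ Fin k → Lp ℝ 1 L.measure) c x) =
      (L.toPOperator A).measure.map ((L.toPOperator A).jointMap
        fun c => ContinuousMap.toLp ∞ L.measure ℝ (F c)) := by
    refine Measure.map_congr ?_
    have h3 : ∀ᵐ x ∂L.measure, ∀ c, (ContinuousMap.toLp 1 L.measure ℝ (F c) : L.Space → ℝ) x =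
        (ContinuousMap.toLp ∞ L.measure ℝ (F c) : L.Space → ℝ) x := by
      rw [ae_all_iff]
      intro c
      filter_upwards [ContinuousMap.coeFn_toLp (p := 1) (𝕜 := ℝ) L.measure (F c),
        ContinuousMap.coeFn_toLp (p := ∞) (𝕜 := ℝ) L.measure (F c)] with x h1 h2
      rw [h1, h2]
    filter_upwards [h3] with x hx
    unfold POperator.jointMap
    congr 1
    ext (c | c)
    · exact hx c
    · have : (L.toPOperator A).op (ContinuousMap.toLp ∞ L.measure ℝ (F c)) =
          A (ContinuousMap.toLp 2 L.measure ℝ (F c)) := congrArg A (L.topToTwo_toLp (F c))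
      exact congrArg (fun h : Lp ℝ 1 L.measure => (h : L.Space → ℝ) x) this.symm
  exact congrArg₂ levyProkhorovEDist e1 e2

end UltraLimit

theorem POperator.edist_jointLaw_le (A : POperator) {k : ℕ} {v w : Fin k → Lp ℝ ∞ A.measure}
    {δ : ℝ≥0∞} (hδ : δ ≠ 0)
    (h : ∑ c, (‖Lp.topToTwo A.measure (v c) - Lp.topToTwo A.measure (w c)‖ₑ +
      ‖A.op (v c) - A.op (w c)‖ₑ) ≤ δ * δ) :
    edist (A.jointLaw v) (A.jointLaw w) ≤ δ := by
  refine (A.edist_jointLaw A v w).trans_le ?_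
  refine levyProkhorovEDist_map_toLp_le
    (f := fun x => Sum.elim (fun i => v i x) (fun i => A.op (v i) x))
    (g := fun x => Sum.elim (fun i => w i x) (fun i => A.op (w i) x)) ?_ ?_ hδ ?_
  · rintro (c | c)
    · exact (Lp.aestronglyMeasurable (v c)).aemeasurable
    · exact (Lp.aestronglyMeasurable (A.op (v c))).aemeasurable
  · rintro (c | c)
    · exact (Lp.aestronglyMeasurable (w c)).aemeasurable
    · exact (Lp.aestronglyMeasurable (A.op (w c))).aemeasurable
  · refine le_trans ?_ h
    rw [Fintype.sum_sum_type, Finset.sum_add_distrib]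
    refine add_le_add (Finset.sum_le_sum fun c _ => ?_) (Finset.sum_le_sum fun c _ => ?_)
    · rw [Lp.enorm_def]
      refine le_trans ?_ (eLpNorm_le_eLpNorm_of_exponent_le one_le_two
        (Lp.aestronglyMeasurable _))
      rw [eLpNorm_one_eq_lintegral_enorm]
      refine (lintegral_congr_ae ?_).le
      filter_upwards [Lp.coeFn_sub (Lp.topToTwo A.measure (v c)) (Lp.topToTwo A.measure (w c))]
        with x hx
      rw [hx]
      rfl
    · rw [Lp.enorm_def, eLpNorm_one_eq_lintegral_enorm]
      refine (lintegral_congr_ae ?_).le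
      filter_upwards [Lp.coeFn_sub (A.op (v c)) (A.op (w c))] with x hx
      rw [hx]
      rfl

/-- Clamping to `[-1, 1]` is a contraction that fixes `x`. Continuous `L²` approximations of a `[-1,
1]`-valued function can therefore be clamped at no cost. -/
theorem abs_sub_clamp_le {x y : ℝ} (hx : x ∈ Set.Icc (-1 : ℝ) 1) :
    |x - max (-1) (min 1 y)| ≤ |x - y| := by
  obtain ⟨h1, h2⟩ := hx
  rcases le_total y (-1) with h | h
  · rw [min_eq_right (by linarith), max_eq_left h, abs_of_nonneg (by linarith),
      abs_of_nonneg (by linarith)]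
    linarith
  · rcases le_total y 1 with h' | h'
    · rw [min_eq_right h', max_eq_right h]
    · rw [min_eq_left h', max_eq_right (by norm_num), abs_of_nonpos (by linarith),
        abs_of_nonpos (by linarith)]
      linarith

namespace UltraLimit

variable {ι : Type} {n : ι → ℕ} {U : Ultrafilter ι} (L : UltraLimit n (U : Filter ι))

theorem exists_norm_topToTwo_sub_le {v : Lp ℝ ∞ L.measure}
    (hv : ∀ᵐ x ∂L.measure, v x ∈ Set.Icc (-1 : ℝ) 1) {η : ℝ} (hη : 0 < η) :
    ∃ F : C(L.Space, ℝ), (∀ x, |F x| ≤ 1) ∧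
      ‖Lp.topToTwo L.measure v - ContinuousMap.toLp 2 L.measure ℝ F‖ ≤ η := by
  obtain ⟨F, hF⟩ := (ContinuousMap.toLp_denseRange ℝ L.measure ℝ
    (by simp : (2 : ℝ≥0∞) ≠ ∞)).exists_dist_lt (Lp.topToTwo L.measure v) hη
  rw [dist_eq_norm] at hF
  refine ⟨⟨fun x => max (-1) (min 1 (F x)), by fun_prop⟩, fun x => ?_, le_trans ?_ hF.le⟩
  · exact abs_le.2 ⟨le_max_left _ _, max_le (by norm_num) (min_le_left _ _)⟩
  · refine Lp.norm_le_norm_of_ae_le ?_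
    filter_upwards [hv, Lp.coeFn_sub (Lp.topToTwo L.measure v) (ContinuousMap.toLp 2 L.measure ℝ F),
      Lp.coeFn_sub (Lp.topToTwo L.measure v) (ContinuousMap.toLp 2 L.measure ℝ
        (⟨fun x => max (-1) (min 1 (F x)), by fun_prop⟩ : C(L.Space, ℝ))),
      ContinuousMap.coeFn_toLp (p := 2) (𝕜 := ℝ) L.measure F,
      ContinuousMap.coeFn_toLp (p := 2) (𝕜 := ℝ) L.measure
        (⟨fun x => max (-1) (min 1 (F x)), by fun_prop⟩ : C(L.Space, ℝ))] with x h1 h2 h3 h4 h5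
    rw [h2, h3, Pi.sub_apply, Pi.sub_apply, h4, h5, Lp.topToTwo_apply]
    exact abs_sub_clamp_le h1

theorem exists_edist_jointLaw_le (A : Lp ℝ 2 L.measure →L[ℝ] Lp ℝ 1 L.measure) {k : ℕ}
    {v : Fin k → Lp ℝ ∞ L.measure}
    (hv : ∀ c, ∀ᵐ x ∂L.measure, v c x ∈ Set.Icc (-1 : ℝ) 1) {δ : ℝ≥0∞} (hδ : δ ≠ 0) :
    ∃ F : Fin k → C(L.Space, ℝ), (∀ c x, |F c x| ≤ 1) ∧
      edist ((L.toPOperator A).jointLaw v)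
        ((L.toPOperator A).jointLaw fun c => ContinuousMap.toLp ∞ L.measure ℝ (F c)) ≤ δ := by
  obtain ⟨d, hd, hdδ⟩ := ENNReal.lt_iff_exists_nnreal_btwn.1 (pos_iff_ne_zero.2 hδ)
  have hd0 : (0 : ℝ) < d := by simpa using hd
  -- Each of the `k` functions contributes an error `η` itself and `‖A‖ η` through its image; the
  -- total must stay below `d²`.
  set η : ℝ := d * d / ((k + 1) * (1 + ‖A‖)) with hη_def
  have hη : 0 < η := by positivity
  choose F hF hF' using fun c => L.exists_norm_topToTwo_sub_le (hv c) hη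
  refine ⟨F, hF, le_trans ?_ hdδ.le⟩
  refine (L.toPOperator A).edist_jointLaw_le (by simpa using hd.ne') ?_
  calc _ ≤ ∑ _c : Fin k, (ENNReal.ofReal η + ENNReal.ofReal (‖A‖ * η)) := by
        refine Finset.sum_le_sum fun c _ => add_le_add ?_ ?_
        · rw [← ofReal_norm]
          refine ENNReal.ofReal_le_ofReal (le_of_eq_of_le ?_ (hF' c))
          exact congrArg (fun z => ‖Lp.topToTwo L.measure (v c) - z‖) (L.topToTwo_toLp (F c))
        · rw [← ofReal_norm]
          refine ENNReal.ofReal_le_ofReal ?_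
          have e : (L.toPOperator A).op (v c) -
              (L.toPOperator A).op (ContinuousMap.toLp ∞ L.measure ℝ (F c)) =
              A (Lp.topToTwo L.measure (v c) - ContinuousMap.toLp 2 L.measure ℝ (F c)) := by
            rw [map_sub, ← L.topToTwo_toLp (F c)]
            rfl
          refine (congrArg norm e).trans_le ((A.le_opNorm _).trans ?_)
          gcongr
          exact hF' c
    _ = ENNReal.ofReal (k * (1 + ‖A‖) * η) := by
        rw [← ENNReal.ofReal_add hη.le (by positivity), Finset.sum_const, Finset.card_univ,
          Fintype.card_fin, nsmul_eq_mul, ← ENNReal.ofReal_natCast,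
          ← ENNReal.ofReal_mul (Nat.cast_nonneg _)]
        congr 1
        ring
    _ ≤ ENNReal.ofReal (d * d) := by
        refine ENNReal.ofReal_le_ofReal ?_
        have : (k + 1) * (1 + ‖A‖) * η = d * d := by
          rw [hη_def]
          field_simp
        rw [← this]
        gcongr
        linarith
    _ = d * d := by rw [ENNReal.ofReal_mul hd0.le, ENNReal.ofReal_coe_nnreal]

end UltraLimit

/-- Along an ultrafilter, uniformly bounded matrices converge to a `P`-operator. -/
theorem exists_tendsto_hausdorffEDist_profile {ι : Type} {n : ι → ℕ} [∀ i, NeZero (n i)]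
    (U : Ultrafilter ι) {C : ℝ} {H : ∀ i, Matrix (Fin (n i)) (Fin (n i)) ℝ}
    (hH : ∀ i, (H i).IsRowBounded C) :
    ∃ A : POperator, ∀ k, Tendsto
      (fun i => Metric.hausdorffEDist ((H i).toPOperator.profile k) (A.profile k)) U (𝓝 0) := by
  obtain ⟨L⟩ := UltraLimit.nonempty n U
  obtain ⟨A, hA⟩ := L.exists_limit_operator hH
  have hmem : ∀ {k : ℕ} {F : Fin k → C(L.Space, ℝ)}, (∀ c x, |F c x| ≤ 1) →
      ((L.toPOperator A).jointLaw fun c => ContinuousMap.toLp ∞ L.measure ℝ (F c)) ∈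
        (L.toPOperator A).profile k := by
    intro k F hF
    refine ⟨_, fun c => ?_, rfl⟩
    filter_upwards [ContinuousMap.coeFn_toLp (p := ∞) (𝕜 := ℝ) L.measure (F c)] with x hx
    have : (ContinuousMap.toLp ∞ L.measure ℝ (F c) : L.Space → ℝ) x ∈ Set.Icc (-1 : ℝ) 1 := by
      rw [hx]
      exact abs_le.1 (hF c x)
    exact this
  refine ⟨L.toPOperator A, fun k => ENNReal.tendsto_nhds_zero.2 fun ε hε => ?_⟩
  -- Otherwise the failure holds for `U`-almost all `i`. Bad vectors, padded by `0` at the good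
  -- indices, extend to continuous functions on the limit space. Their joint laws converge to a
  -- point of the limit profile, a contradiction.
  have h1 : ∀ᶠ i in (U : Filter ι), ∀ x ∈ (H i).toPOperator.profile k,
      ∃ y ∈ (L.toPOperator A).profile k, edist x y ≤ ε := by
    by_contra hcon
    rw [← Ultrafilter.eventually_not] at hcon
    have : ∀ i, ∃ v : Fin k → Fin (n i) → ℝ, (∀ c j, |v c j| ≤ 1) ∧
        ((¬ ∀ x ∈ (H i).toPOperator.profile k,
          ∃ y ∈ (L.toPOperator A).profile k, edist x y ≤ ε) →
          ∀ y ∈ (L.toPOperator A).profile k,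
            ¬ edist ((H i).toPOperator.jointLaw fun c => Matrix.toLpTop (v c)) y ≤ ε) := by
      intro i
      by_cases hi : ∀ x ∈ (H i).toPOperator.profile k,
          ∃ y ∈ (L.toPOperator A).profile k, edist x y ≤ ε
      · exact ⟨0, by simp, fun h => absurd hi h⟩
      · push Not at hi
        obtain ⟨x, hx, hxy⟩ := hi
        obtain ⟨v, hv, rfl⟩ := Matrix.mem_profile_toPOperator.1 hx
        exact ⟨v, hv, fun _ y hy => not_le.2 (hxy y hy)⟩
    choose v hv hv' using this
    choose F hF hF' using fun c => L.exists_extend (fun i => v i c) 1 zero_le_one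
      fun i j => hv i c j
    have hlim := UltraLimit.tendsto_edist_jointLaw hA F
    simp only [hF] at hlim
    obtain ⟨i, hi, hi'⟩ := (hcon.and (ENNReal.tendsto_nhds_zero.1 hlim ε hε)).exists
    exact hv' i hi _ (hmem hF') hi'
  -- The limit profile is totally bounded, so finitely many `y` suffice. For each one, the functions
  -- are approximated by continuous ones, which are then restricted to the finite spaces.
  have h2 : ∀ᶠ i in (U : Filter ι), ∀ y ∈ (L.toPOperator A).profile k,
      ∃ x ∈ (H i).toPOperator.profile k, edist y x ≤ ε := by
    have hε3 : 0 < ε / 3 := ENNReal.div_pos hε.ne' (by simp)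
    obtain ⟨t, ht, htf, htc⟩ := EMetric.totallyBounded_iff'.1
      ((L.toPOperator A).totallyBounded_profile k) (ε / 3) hε3
    have h3 : ∀ y ∈ t, ∀ᶠ i in (U : Filter ι), ∃ x ∈ (H i).toPOperator.profile k,
        edist y x ≤ ε / 3 + ε / 3 := by
      intro y hy
      obtain ⟨w, hw, rfl⟩ := ht hy
      obtain ⟨F, hF, hF'⟩ := L.exists_edist_jointLaw_le A hw hε3.ne'
      filter_upwards [ENNReal.tendsto_nhds_zero.1 (UltraLimit.tendsto_edist_jointLaw hA F) _ hε3]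
        with i hi
      refine ⟨_, Matrix.mem_profile_toPOperator.2 ⟨fun c j => F c (L.pt i j),
        fun c j => hF c _, rfl⟩, ?_⟩
      refine (edist_triangle _ _ _).trans (add_le_add hF' ?_)
      rw [edist_comm]
      exact hi
    filter_upwards [(eventually_all_finite htf).2 h3] with i hi y hy
    obtain ⟨z, hz, hyz⟩ := Set.mem_iUnion₂.1 (htc hy)
    obtain ⟨x, hx, hzx⟩ := hi z hz
    refine ⟨x, hx, (edist_triangle y z x).trans ?_⟩
    calc edist y z + edist z x ≤ ε / 3 + (ε / 3 + ε / 3) := add_le_add (le_of_lt hyz) hzx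
      _ = ε := by rw [← add_assoc, ENNReal.add_thirds]
  filter_upwards [h1, h2] with i hi1 hi2
  exact Metric.hausdorffEDist_le_of_mem_edist hi1 hi2

/-! ### McDiarmid's inequality by counting -/

section FiniteMean

open Real

theorem exp_sub_mean_le {X : Type*} [Fintype X] [Nonempty X] (g : X → ℝ) (a : ℝ) :
    exp (a - (Fintype.card X : ℝ)⁻¹ * ∑ y, g y) ≤
      (Fintype.card X : ℝ)⁻¹ * ∑ y, exp (a - g y) := by
  have hN : (0 : ℝ) < Fintype.card X := by exact_mod_cast Fintype.card_pos
  have h := convexOn_exp.map_sum_le (t := Finset.univ) (w := fun _ : X => (Fintype.card X : ℝ)⁻¹)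
    (p := fun y => a - g y) (fun _ _ => by positivity) (by simp [hN.ne']) (fun _ _ => trivial)
  simp only [smul_eq_mul, ← Finset.mul_sum, Finset.sum_sub_distrib, Finset.sum_const,
    Finset.card_univ, nsmul_eq_mul, mul_sub, inv_mul_cancel_left₀ hN.ne'] at h
  exact h

/-- Symmetrization: Jensen's inequality replaces the mean by an independent copy, exchanging the
copies turns `exp` into `cosh`, and `cosh u ≤ exp (u² / 2)`. The constant is weaker than Hoeffding's
but sufficient. -/
theorem sum_exp_sub_mean_le {X : Type*} [Fintype X] [Nonempty X] {g : X → ℝ} {c : ℝ}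
    (hg : ∀ x y, |g x - g y| ≤ c) (s : ℝ) :
    ∑ x, exp (s * (g x - (Fintype.card X : ℝ)⁻¹ * ∑ y, g y)) ≤
      Fintype.card X * exp ((s * c) ^ 2 / 2) := by
  have hN : (0 : ℝ) < Fintype.card X := by exact_mod_cast Fintype.card_pos
  have h1 : ∑ x, exp (s * (g x - (Fintype.card X : ℝ)⁻¹ * ∑ y, g y)) ≤
      ∑ x, (Fintype.card X : ℝ)⁻¹ * ∑ y, exp (s * (g x - g y)) := by
    refine Finset.sum_le_sum fun x _ => ?_
    have := exp_sub_mean_le (fun y => s * g y) (s * g x)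
    rw [← Finset.mul_sum] at this
    calc exp (s * (g x - (Fintype.card X : ℝ)⁻¹ * ∑ y, g y))
        = exp (s * g x - (Fintype.card X : ℝ)⁻¹ * (s * ∑ y, g y)) := by ring_nf
      _ ≤ _ := this
      _ = _ := by simp only [mul_sub]
  have h2 : ∑ x, ∑ y, exp (s * (g x - g y)) = ∑ x, ∑ y, cosh (s * (g x - g y)) := by
    have h3 : ∑ x, ∑ y, exp (s * (g x - g y)) = ∑ x, ∑ y, exp (-(s * (g x - g y))) := by
      rw [Finset.sum_comm]
      refine Finset.sum_congr rfl fun x _ => Finset.sum_congr rfl fun y _ => ?_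
      ring_nf
    simp only [cosh_eq, ← Finset.sum_div, Finset.sum_add_distrib]
    rw [← h3]
    ring
  rw [← Finset.mul_sum, h2] at h1
  refine h1.trans ?_
  calc (Fintype.card X : ℝ)⁻¹ * ∑ x, ∑ y, cosh (s * (g x - g y))
      ≤ (Fintype.card X : ℝ)⁻¹ * ∑ _x : X, ∑ _y : X, exp ((s * c) ^ 2 / 2) := by
        gcongr with x _ y _
        refine (cosh_le_exp_half_sq _).trans (exp_le_exp.2 ?_)
        rw [mul_pow, mul_pow]
        have := sq_le_sq' (abs_le.1 (hg x y)).1 (abs_le.1 (hg x y)).2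
        gcongr
    _ = Fintype.card X * exp ((s * c) ^ 2 / 2) := by
        simp only [Finset.sum_const, Finset.card_univ, nsmul_eq_mul]
        rw [inv_mul_cancel_left₀ hN.ne']

theorem Fin.sum_fun_succ {X : Type*} [Fintype X] {m : ℕ} (f : (Fin (m + 1) → X) → ℝ) :
    ∑ x, f x = ∑ a, ∑ y : Fin m → X, f (Fin.cons a y) := by
  rw [← (Fin.consEquiv fun _ : Fin (m + 1) => X).sum_comp, Fintype.sum_prod_type]
  rfl

/-- The exponential moment bound behind **McDiarmid's inequality**. -/
theorem sum_exp_sub_mean_le_of_bounded_differences {X : Type*} [Fintype X] [Nonempty X] {c : ℝ}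
    (s : ℝ) : ∀ {m : ℕ} {f : (Fin m → X) → ℝ},
    (∀ x y i, (∀ j, j ≠ i → x j = y j) → |f x - f y| ≤ c) →
    ∑ x, exp (s * (f x - ((Fintype.card X : ℝ) ^ m)⁻¹ * ∑ y, f y)) ≤
      (Fintype.card X : ℝ) ^ m * exp (m * ((s * c) ^ 2 / 2)) := by
  have hN : (0 : ℝ) < Fintype.card X := by exact_mod_cast Fintype.card_pos
  intro m
  induction m with
  | zero => intro f _; simp
  | succ m ih =>
    intro f hf
    -- The conditional mean given the first variable. It inherits the bounded difference `c`, and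
    -- the deviation of `f` splits as `(f - g) + (g - mean)`: induction handles the first term, the
    -- one-variable bound the second.
    set g : X → ℝ := fun a => ((Fintype.card X : ℝ) ^ m)⁻¹ * ∑ y : Fin m → X, f (Fin.cons a y)
    have hg : ∀ a b, |g a - g b| ≤ c := by
      intro a b
      simp only [g]
      rw [← mul_sub, ← Finset.sum_sub_distrib, abs_mul, abs_of_pos (by positivity),
        inv_mul_le_iff₀ (by positivity)]
      calc |∑ y : Fin m → X, (f (Fin.cons a y) - f (Fin.cons b y))|
          ≤ ∑ y : Fin m → X, |f (Fin.cons a y) - f (Fin.cons b y)| :=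
            Finset.abs_sum_le_sum_abs _ _
        _ ≤ ∑ _y : Fin m → X, c := by
            refine Finset.sum_le_sum fun y _ => hf _ _ 0 fun j hj => ?_
            obtain ⟨i, rfl⟩ := Fin.exists_succ_eq.2 hj
            simp
        _ = (Fintype.card X : ℝ) ^ m * c := by simp
    have hmean : ((Fintype.card X : ℝ) ^ (m + 1))⁻¹ * ∑ y, f y =
        (Fintype.card X : ℝ)⁻¹ * ∑ a, g a := by
      rw [Fin.sum_fun_succ, ← Finset.mul_sum, pow_succ', mul_inv, mul_assoc]
    have hstep : ∀ a, ∑ y : Fin m → X, exp (s * (f (Fin.cons a y) - g a)) ≤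
        (Fintype.card X : ℝ) ^ m * exp (m * ((s * c) ^ 2 / 2)) := by
      intro a
      refine ih (f := fun y => f (Fin.cons a y)) fun x y i hxy => hf _ _ i.succ fun j hj => ?_
      induction j using Fin.cases with
      | zero => simp
      | succ j => simpa using hxy j fun h => hj (by rw [h])
    rw [hmean, Fin.sum_fun_succ fun x => exp (s * (f x - (Fintype.card X : ℝ)⁻¹ * ∑ a, g a))]
    calc ∑ a, ∑ y : Fin m → X, exp (s * (f (Fin.cons a y) - (Fintype.card X : ℝ)⁻¹ * ∑ a, g a))
        = ∑ a, exp (s * (g a - (Fintype.card X : ℝ)⁻¹ * ∑ a, g a)) *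
            ∑ y : Fin m → X, exp (s * (f (Fin.cons a y) - g a)) := by
          refine Finset.sum_congr rfl fun a _ => ?_
          refine Eq.trans (Finset.sum_congr rfl fun y _ => ?_) (Finset.mul_sum _ _ _).symm
          rw [← exp_add]
          ring_nf
      _ ≤ ∑ a, exp (s * (g a - (Fintype.card X : ℝ)⁻¹ * ∑ a, g a)) *
            ((Fintype.card X : ℝ) ^ m * exp (m * ((s * c) ^ 2 / 2))) := by
          gcongr with a _
          exact hstep a
      _ ≤ (Fintype.card X * exp ((s * c) ^ 2 / 2)) *
            ((Fintype.card X : ℝ) ^ m * exp (m * ((s * c) ^ 2 / 2))) := by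
          rw [← Finset.sum_mul]
          gcongr
          exact sum_exp_sub_mean_le hg s
      _ = _ := by
          rw [Nat.cast_succ, add_one_mul, exp_add]
          ring

theorem ncard_mul_exp_le {X : Type*} [Fintype X] (f : X → ℝ) (t : ℝ) :
    ({x | t < f x}.ncard : ℝ) * exp t ≤ ∑ x, exp (f x) := by
  classical
  rw [Set.ncard_eq_toFinset_card', ← nsmul_eq_mul]
  calc _ ≤ ∑ x ∈ {x | t < f x}.toFinset, exp (f x) := by
        refine Finset.card_nsmul_le_sum _ _ _ fun x hx => ?_
        exact exp_le_exp.2 (le_of_lt (by simpa using hx))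
    _ ≤ ∑ x, exp (f x) :=
        Finset.sum_le_sum_of_subset_of_nonneg (Finset.subset_univ _) fun _ _ _ => (exp_pos _).le

/-- **McDiarmid's inequality** for a function of `m` independent uniform variables which changes
by at most `1 / m` if one variable changes. -/
theorem ncard_lt_abs_sub_mean_le {X : Type*} [Fintype X] [Nonempty X] {m : ℕ} (hm : 0 < m)
    {f : (Fin m → X) → ℝ} (hf : ∀ x y i, (∀ j, j ≠ i → x j = y j) → |f x - f y| ≤ (m : ℝ)⁻¹)
    {t : ℝ} (ht : 0 < t) : ({x | t < |f x - ((Fintype.card X : ℝ) ^ m)⁻¹ * ∑ y, f y|}.ncard : ℝ) ≤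
      2 * ((Fintype.card X : ℝ) ^ m * exp (-(m * t ^ 2 / 2))) := by
  have hm' : (0 : ℝ) < m := by exact_mod_cast hm
  set M := ((Fintype.card X : ℝ) ^ m)⁻¹ * ∑ y, f y
  -- Both tails at once, with `σ = ±1` and exponential parameter `s = σ m t`. Since `c = 1 / m`, the
  -- exponent is `m t² / 2 - m t²`.
  have key : ∀ σ : ℝ, σ ^ 2 = 1 → ({x | m * t ^ 2 < σ * (m * t) * (f x - M)}.ncard : ℝ) ≤
      (Fintype.card X : ℝ) ^ m * exp (-(m * t ^ 2 / 2)) := by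
    intro σ hσ
    have h1 := ncard_mul_exp_le (fun x => σ * (m * t) * (f x - M)) (m * t ^ 2)
    have h2 := h1.trans (sum_exp_sub_mean_le_of_bounded_differences (σ * (m * t)) hf)
    rw [← le_div_iff₀ (exp_pos _), mul_div_assoc, ← exp_sub] at h2
    refine h2.trans_eq ?_
    congr 2
    rw [show (σ * (m * t) * (m : ℝ)⁻¹) = σ * t by field_simp, mul_pow, hσ]
    ring
  have hsub : {x | t < |f x - M|} ⊆ {x | m * t ^ 2 < 1 * (m * t) * (f x - M)} ∪
      {x | m * t ^ 2 < (-1) * (m * t) * (f x - M)} := by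
    intro x hx
    have hmt : 0 < m * t := mul_pos hm' ht
    rcases lt_abs.1 (show t < |f x - M| from hx) with h | h
    · left
      show m * t ^ 2 < 1 * (m * t) * (f x - M)
      nlinarith
    · right
      show m * t ^ 2 < (-1) * (m * t) * (f x - M)
      nlinarith
  have hcard : ({x | t < |f x - M|}.ncard : ℝ) ≤
      ({x | m * t ^ 2 < 1 * (m * t) * (f x - M)}.ncard : ℝ) +
        ({x | m * t ^ 2 < (-1) * (m * t) * (f x - M)}.ncard : ℝ) := by
    exact_mod_cast (Set.ncard_le_ncard hsub).trans (Set.ncard_union_le _ _)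
  linarith [key 1 (by norm_num), key (-1) (by norm_num)]

end FiniteMean

/-! ### Norm bounds for random sign matrices -/

/-- The sign `±1` encoded by a Boolean. -/
noncomputable def boolSign (b : Bool) : ℝ := if b then 1 else -1

theorem boolSign_sq (b : Bool) : boolSign b ^ 2 = 1 := by
  cases b <;> simp [boolSign]

theorem boolSign_decide_mul (y : ℝ) : boolSign (decide (0 ≤ y)) * y = |y| := by
  by_cases h : 0 ≤ y
  · simp [boolSign, h, abs_of_nonneg h]
  · simp [boolSign, h, abs_of_neg (not_le.1 h)]

open Real in
-- Induction on the number of signs; the shift `x` absorbs the sign already exposed. Averaging over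
-- one sign produces a `cosh`, bounded by a Gaussian, and the coefficients obey `(1 - 2rS)(1 - 2μa²)
-- = 1 - 2r(a² + S)`.
theorem sum_exp_sq_le {r : ℝ} (hr : 0 < r) : ∀ {m : ℕ} {a : Fin m → ℝ} (x : ℝ),
    2 * r * ∑ j, a j ^ 2 < 1 →
    ∑ b : Fin m → Bool, exp (r * (x + ∑ j, a j * boolSign (b j)) ^ 2) ≤
      2 ^ m * exp (r / (1 - 2 * r * ∑ j, a j ^ 2) * (x ^ 2 + ∑ j, a j ^ 2)) := by
  intro m
  induction m with
  | zero => intro a x _; simp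
  | succ m ih =>
    intro a x hS
    rw [Fin.sum_univ_succ] at hS
    set S := ∑ j : Fin m, a j.succ ^ 2 with hS_def
    set μ := r / (1 - 2 * r * S) with hμ_def
    have hSn : 0 ≤ S := Finset.sum_nonneg fun _ _ => sq_nonneg _
    have h1 : 0 < 1 - 2 * r * S := by nlinarith [sq_nonneg (a 0), mul_nonneg hr.le (sq_nonneg (a 0))]
    have hμ : 0 < μ := div_pos hr h1
    have h2 : 1 - 2 * r * (a 0 ^ 2 + S) = (1 - 2 * r * S) * (1 - 2 * μ * a 0 ^ 2) := by
      rw [hμ_def]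
      field_simp
      ring
    have h3 : 0 < 1 - 2 * μ * a 0 ^ 2 := by
      have : 0 < (1 - 2 * r * S) * (1 - 2 * μ * a 0 ^ 2) := by rw [← h2]; linarith
      exact (pos_iff_pos_of_mul_pos this).1 h1
    -- This is `1 + u ≤ 1 / (1 - u)` with `u = 2 μ a₀²`, multiplied by `μ`.
    have h4 : μ + 2 * μ ^ 2 * a 0 ^ 2 ≤ r / (1 - 2 * r * (a 0 ^ 2 + S)) := by
      rw [h2, ← div_div, ← hμ_def, le_div_iff₀ h3]
      nlinarith [mul_nonneg hμ.le (sq_nonneg (μ * a 0 ^ 2))]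
    have h5 : μ ≤ r / (1 - 2 * r * (a 0 ^ 2 + S)) := le_trans (by
      have : 0 ≤ μ ^ 2 * a 0 ^ 2 := by positivity
      linarith) h4
    rw [Fin.sum_fun_succ]
    simp only [Fin.sum_univ_succ, Fin.cons_zero, Fin.cons_succ, ← add_assoc]
    rw [add_comm (a 0 ^ 2), ← hS_def]
    calc ∑ s, ∑ y : Fin m → Bool,
          exp (r * (x + a 0 * boolSign s + ∑ j, a j.succ * boolSign (y j)) ^ 2)
        ≤ ∑ s, 2 ^ m * exp (μ * ((x + a 0 * boolSign s) ^ 2 + S)) := by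
          gcongr with s _
          exact ih (x + a 0 * boolSign s) (by linarith)
      _ = 2 ^ (m + 1) * (exp (μ * (x ^ 2 + a 0 ^ 2 + S)) * cosh (2 * μ * x * a 0)) := by
          rw [Fintype.sum_bool, cosh_eq, pow_succ (2 : ℝ) m]
          have e1 : exp (μ * ((x + a 0 * boolSign true) ^ 2 + S)) =
              exp (μ * (x ^ 2 + a 0 ^ 2 + S)) * exp (2 * μ * x * a 0) := by
            rw [← exp_add]; simp only [boolSign, if_true]; ring_nf
          have e2 : exp (μ * ((x + a 0 * boolSign false) ^ 2 + S)) =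
              exp (μ * (x ^ 2 + a 0 ^ 2 + S)) * exp (-(2 * μ * x * a 0)) := by
            rw [← exp_add]; simp only [boolSign, Bool.false_eq_true, if_false]; ring_nf
          rw [e1, e2]
          ring
      _ ≤ 2 ^ (m + 1) * (exp (μ * (x ^ 2 + a 0 ^ 2 + S)) *
            exp ((2 * μ * x * a 0) ^ 2 / 2)) := by
          gcongr
          exact cosh_le_exp_half_sq _
      _ ≤ _ := by
          rw [← exp_add]
          gcongr
          have h6 := mul_le_mul_of_nonneg_right h4 (sq_nonneg x)
          have h7 := mul_le_mul_of_nonneg_right h5 (add_nonneg hSn (sq_nonneg (a 0)))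
          rw [add_comm (a 0 ^ 2) S] at h6 h7
          simp only [add_assoc] at *
          nlinarith

/-- The matrix with entries `±n^{-1/2}` whose columns have the given signs. -/
noncomputable def signMat {n : ℕ} (x : Fin n → Fin n → Bool) : Matrix (Fin n) (Fin n) ℝ :=
  Matrix.of fun i j => boolSign (x j i) * (Real.sqrt n)⁻¹

open Real in
-- For fixed `w` and `r = 1/4` each column has exponential moment at most `e^{1/2}`. By independence
-- of the columns, the sum exceeds `16 n` with probability at most `e^{n/2 - 4n} ≤ e^{-3n}`. The
-- union over `2^n ≤ e^n` sign vectors leaves `e^{-2n}`.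
theorem ncard_exists_lt_sum_sq_le {n : ℕ} (hn : 0 < n) :
    ({x : Fin n → Fin n → Bool | ∃ w : Fin n → Bool,
      16 * n < ∑ j, (∑ i, boolSign (w i) * (boolSign (x j i) * (√n)⁻¹)) ^ 2}.ncard : ℝ) ≤
      (2 ^ n) ^ n * exp (-(2 * n)) := by
  have hn' : (0 : ℝ) < n := by exact_mod_cast hn
  have key : ∀ w : Fin n → Bool, ({x : Fin n → Fin n → Bool |
      16 * n < ∑ j, (∑ i, boolSign (w i) * (boolSign (x j i) * (√n)⁻¹)) ^ 2}.ncard : ℝ) ≤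
      (2 ^ n) ^ n * exp (-(3 * n)) := by
    intro w
    have hS : ∑ i, (boolSign (w i) * (√n)⁻¹) ^ 2 = 1 := by
      simp [mul_pow, boolSign_sq, hn'.le, hn'.ne']
    have h1 := sum_exp_sq_le (r := 1 / 4) (by norm_num) (a := fun i => boolSign (w i) * (√n)⁻¹) 0
      (by rw [hS]; norm_num)
    rw [hS] at h1
    have h2 := ncard_mul_exp_le (fun x : Fin n → Fin n → Bool =>
      ∑ j, 1 / 4 * (0 + ∑ i, boolSign (w i) * (√n)⁻¹ * boolSign (x j i)) ^ 2) (4 * n)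
    simp only [exp_sum] at h2
    rw [← Fintype.sum_pow (fun b : Fin n → Bool =>
      exp (1 / 4 * (0 + ∑ i, boolSign (w i) * (√n)⁻¹ * boolSign (b i)) ^ 2))] at h2
    have h3 := h2.trans (pow_le_pow_left₀ (Finset.sum_nonneg fun _ _ => (exp_pos _).le) h1 n)
    rw [mul_pow, ← exp_nat_mul, ← le_div_iff₀ (exp_pos _), mul_div_assoc, ← exp_sub] at h3
    refine le_trans (le_of_eq ?_) (h3.trans ?_)
    · congr 2
      ext x
      simp only [zero_add, ← Finset.mul_sum, Set.mem_ofPred_eq, mul_assoc,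
        mul_comm (√n)⁻¹]
      constructor <;> intro h <;> linarith
    · gcongr
      norm_num
      linarith
  have hset : {x : Fin n → Fin n → Bool | ∃ w : Fin n → Bool,
      16 * n < ∑ j, (∑ i, boolSign (w i) * (boolSign (x j i) * (√n)⁻¹)) ^ 2} =
      ⋃ w : Fin n → Bool, {x : Fin n → Fin n → Bool |
      16 * n < ∑ j, (∑ i, boolSign (w i) * (boolSign (x j i) * (√n)⁻¹)) ^ 2} := by
    ext x; simp
  rw [hset]
  calc _ ≤ ∑ w : Fin n → Bool, ({x : Fin n → Fin n → Bool |
      16 * n < ∑ j, (∑ i, boolSign (w i) * (boolSign (x j i) * (√n)⁻¹)) ^ 2}.ncard : ℝ) := by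
        exact_mod_cast Set.ncard_iUnion_le_of_fintype _
    _ ≤ ∑ _w : Fin n → Bool, (2 ^ n) ^ n * exp (-(3 * n)) :=
        Finset.sum_le_sum fun w _ => key w
    _ = (2 ^ n) ^ n * (2 ^ n * exp (-(3 * n))) := by
        simp
        ring
    _ ≤ (2 ^ n) ^ n * (exp 1 ^ n * exp (-(3 * n))) := by
        gcongr
        linarith [add_one_le_exp (1 : ℝ)]
    _ = (2 ^ n) ^ n * exp (-(2 * n)) := by
        rw [← exp_nat_mul, ← exp_add]
        ring_nf

/-- A convex function on the cube is largest at a vertex, which gives the `L^∞ → L²` bound. The `L²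
→ L¹` bound is dual: write the `L¹` norm with the signs of `vH` and apply Cauchy–Schwarz, which
leads to the transpose of `H`. -/
theorem Matrix.isRowBounded_of_sum_boolSign_sq_le {n : ℕ} (hn : 0 < n) {C : ℝ} (hC : 0 ≤ C)
    {H : Matrix (Fin n) (Fin n) ℝ}
    (h1 : ∀ w : Fin n → Bool, ∑ j, (∑ i, boolSign (w i) * H i j) ^ 2 ≤ C ^ 2 * n)
    (h2 : ∀ w : Fin n → Bool, ∑ i, (∑ j, boolSign (w j) * H i j) ^ 2 ≤ C ^ 2 * n) :
    H.IsRowBounded C := by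
  have : NeZero n := ⟨hn.ne'⟩
  have hn' : (0 : ℝ) < n := by exact_mod_cast hn
  refine ⟨fun v hv => ?_, fun v => ?_⟩
  · have hconv : ConvexOn ℝ Set.univ fun v : Fin n → ℝ => ∑ j, (v ᵥ* H) j ^ 2 := by
      have hj : ∀ j, ConvexOn ℝ Set.univ fun v : Fin n → ℝ => (v ᵥ* H) j ^ 2 := fun j =>
        (even_two.convexOn_pow (𝕜 := ℝ)).comp_linearMap
          ((LinearMap.proj j).comp (Matrix.vecMulLinear H))
      refine ⟨convex_univ, fun x _ y _ a b ha hb hab => ?_⟩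
      simp only [smul_eq_mul, Finset.mul_sum, ← Finset.sum_add_distrib]
      exact Finset.sum_le_sum fun j _ => (hj j).2 trivial trivial ha hb hab
    have hmem : v ∈ convexHull ℝ (Set.univ.pi fun _ : Fin n => ({-1, 1} : Set ℝ)) := by
      rw [convexHull_pi]
      intro j _
      rw [convexHull_pair, segment_eq_Icc (by norm_num)]
      exact abs_le.1 (hv j)
    obtain ⟨y, hy, hvy⟩ := hconv.exists_ge_of_mem_convexHull (Set.subset_univ _) hmem
    have hyw : y = fun i => boolSign (decide (0 ≤ y i)) := by
      ext i
      rcases hy i trivial with h | h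
      · simp [boolSign, h]
      · simp [boolSign, Set.mem_singleton_iff.1 h]
    rw [integral_uniformFin, inv_mul_le_iff₀ hn', mul_comm]
    refine hvy.trans (le_trans (le_of_eq ?_) (h1 fun i => decide (0 ≤ y i)))
    conv_lhs => rw [hyw]
    rfl
  · set w : Fin n → Bool := fun j => decide (0 ≤ (v ᵥ* H) j)
    have e1 : ∑ j, |(v ᵥ* H) j| = ∑ i, v i * ∑ j, boolSign (w j) * H i j := by
      simp only [← boolSign_decide_mul, Matrix.vecMul, dotProduct, Finset.mul_sum]
      rw [Finset.sum_comm]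
      refine Finset.sum_congr rfl fun i _ => Finset.sum_congr rfl fun j _ => ?_
      simp only [w, Matrix.vecMul, dotProduct]
      ring
    rw [integral_uniformFin, integral_uniformFin, e1]
    calc (n : ℝ)⁻¹ * ∑ i, v i * ∑ j, boolSign (w j) * H i j
        ≤ (n : ℝ)⁻¹ * (√(∑ i, v i ^ 2) * √(∑ i, (∑ j, boolSign (w j) * H i j) ^ 2)) := by
          gcongr
          exact Real.sum_mul_le_sqrt_mul_sqrt _ _ _
      _ ≤ (n : ℝ)⁻¹ * (√(∑ i, v i ^ 2) * √(C ^ 2 * n)) := by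
          gcongr
          exact h2 w
      _ = C * √((n : ℝ)⁻¹ * ∑ i, v i ^ 2) := by
          rw [Real.sqrt_mul (sq_nonneg C), Real.sqrt_sq hC, Real.sqrt_mul (by positivity),
            Real.sqrt_inv]
          have := Real.mul_self_sqrt hn'.le
          have h0 : √(n : ℝ) ≠ 0 := (Real.sqrt_pos.2 hn').ne'
          field_simp
          rw [Real.sq_sqrt hn'.le]
          ring

theorem ncard_not_isRowBounded_le {n : ℕ} (hn : 0 < n) :
    ({x : Fin n → Fin n → Bool | ¬ (signMat x).IsRowBounded 4}.ncard : ℝ) ≤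
      2 * ((2 ^ n) ^ n * Real.exp (-(2 * n))) := by
  set B := {x : Fin n → Fin n → Bool | ∃ w : Fin n → Bool,
      16 * n < ∑ j, (∑ i, boolSign (w i) * (boolSign (x j i) * (√n)⁻¹)) ^ 2} with hB
  have hsub : {x : Fin n → Fin n → Bool | ¬ (signMat x).IsRowBounded 4} ⊆
      B ∪ Function.swap '' B := by
    intro x hx
    by_contra hcon
    refine hx (Matrix.isRowBounded_of_sum_boolSign_sq_le hn (by norm_num) (fun w => ?_) fun w => ?_)
    · by_contra hw
      refine hcon (Or.inl ⟨w, ?_⟩)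
      rw [not_le] at hw
      norm_num at hw
      exact hw
    · by_contra hw
      refine hcon (Or.inr ⟨Function.swap x, ⟨w, ?_⟩, rfl⟩)
      rw [not_le] at hw
      norm_num at hw
      exact hw
  have h1 := (Set.ncard_le_ncard hsub).trans ((Set.ncard_union_le _ _).trans
    (Nat.add_le_add_left (Set.ncard_image_le (Set.toFinite B)) _))
  have h2 : ({x : Fin n → Fin n → Bool | ¬ (signMat x).IsRowBounded 4}.ncard : ℝ) ≤
      B.ncard + B.ncard := by exact_mod_cast h1
  have h3 := ncard_exists_lt_sum_sq_le hn
  linarith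

/-! ### Concentration of the distance to a profile -/

/-- Only the value at `j₀`, a point of mass `1 / n`, can differ, however large the change there; the
Lévy–Prokhorov distance sees just the mass. -/
theorem edist_jointLaw_le_inv {n k : ℕ} [NeZero n] {H H' : Matrix (Fin n) (Fin n) ℝ} {j₀ : Fin n}
    (h : ∀ j, j ≠ j₀ → ∀ i, H i j = H' i j) (v : Fin k → Fin n → ℝ) :
    edist (H.toPOperator.jointLaw fun c => Matrix.toLpTop (v c))
      (H'.toPOperator.jointLaw fun c => Matrix.toLpTop (v c)) ≤ (n : ℝ≥0∞)⁻¹ := by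
  refine (POperator.edist_jointLaw H.toPOperator H'.toPOperator _ _).trans_le ?_
  refine levyProkhorovEDist_map_le (H.toPOperator.aemeasurable_jointMap _)
    (H'.toPOperator.aemeasurable_jointMap _) ?_
  have hsub : {j : Fin n | (n : ℝ≥0∞)⁻¹ <
      edist (H.toPOperator.jointMap (fun c => Matrix.toLpTop (v c)) j)
        (H'.toPOperator.jointMap (fun c => Matrix.toLpTop (v c)) j)} ⊆ {j₀} := by
    intro j hj
    by_contra hne
    have e : H.toPOperator.jointMap (fun c => Matrix.toLpTop (v c)) j =
        H'.toPOperator.jointMap (fun c => Matrix.toLpTop (v c)) j := by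
      rw [Matrix.jointMap_toLpTop, Matrix.jointMap_toLpTop]
      have : ∀ c, (v c ᵥ* H) j = (v c ᵥ* H') j := fun c => by
        simp only [Matrix.vecMul, dotProduct, h j hne]
      simp only [this]
    rw [Set.mem_ofPred_eq, e, edist_self] at hj
    exact not_lt_bot hj
  refine (measure_mono hsub).trans (le_of_eq ?_)
  show uniformFin n {j₀} = _
  rw [uniformOn_univ]
  simp

/-- The distance from a measure to the `k`-profile of a matrix. -/
noncomputable def infDistProfile {n k : ℕ} [NeZero n]
    (η : LevyProkhorov (ProbabilityMeasure (POperator.ProfileSpace k)))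
    (H : Matrix (Fin n) (Fin n) ℝ) : ℝ :=
  (Metric.infEDist η (H.toPOperator.profile k)).toReal

theorem infEDist_profile_le_add {n k : ℕ} [NeZero n] {H H' : Matrix (Fin n) (Fin n) ℝ} {j₀ : Fin n}
    (h : ∀ j, j ≠ j₀ → ∀ i, H i j = H' i j)
    (η : LevyProkhorov (ProbabilityMeasure (POperator.ProfileSpace k))) :
    Metric.infEDist η (H'.toPOperator.profile k) ≤
      Metric.infEDist η (H.toPOperator.profile k) + (n : ℝ≥0∞)⁻¹ := by
  conv_rhs => rw [Metric.infEDist]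
  simp only [ENNReal.iInf_add]
  refine le_iInf₂ fun x hx => ?_
  obtain ⟨v, hv, rfl⟩ := Matrix.mem_profile_toPOperator.1 hx
  refine (Metric.infEDist_le_edist_of_mem
    (Matrix.mem_profile_toPOperator.2 ⟨v, hv, rfl⟩)).trans ((edist_triangle _ _ _).trans
      (add_le_add le_rfl (edist_jointLaw_le_inv h v)))

theorem infEDist_profile_ne_top (A : POperator) {k : ℕ}
    (η : LevyProkhorov (ProbabilityMeasure (POperator.ProfileSpace k))) :
    Metric.infEDist η (A.profile k) ≠ ∞ :=
  Metric.infEDist_ne_top (A.profile_nonempty k)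

theorem abs_infDistProfile_sub_le {n k : ℕ} [NeZero n] {H H' : Matrix (Fin n) (Fin n) ℝ}
    {j₀ : Fin n} (h : ∀ j, j ≠ j₀ → ∀ i, H i j = H' i j)
    (η : LevyProkhorov (ProbabilityMeasure (POperator.ProfileSpace k))) :
    |infDistProfile η H - infDistProfile η H'| ≤ (n : ℝ)⁻¹ := by
  have key : ∀ {H H' : Matrix (Fin n) (Fin n) ℝ}, (∀ j, j ≠ j₀ → ∀ i, H i j = H' i j) →
      infDistProfile η H' ≤ infDistProfile η H + (n : ℝ)⁻¹ := by
    intro H H' h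
    have hn : (n : ℝ≥0∞)⁻¹ ≠ ∞ := by simp [NeZero.ne n]
    have := ENNReal.toReal_mono (ENNReal.add_ne_top.2 ⟨infEDist_profile_ne_top _ η, hn⟩)
      (infEDist_profile_le_add h η)
    rw [ENNReal.toReal_add (infEDist_profile_ne_top _ η) hn] at this
    simpa [infDistProfile] using this
  rw [abs_le]
  constructor <;> linarith [key h, key fun j hj i => (h j hj i).symm]

/-- The mean of `infDistProfile η` over all sign matrices. -/
noncomputable def meanInfDistProfile (n : ℕ) {k : ℕ} [NeZero n]
    (η : LevyProkhorov (ProbabilityMeasure (POperator.ProfileSpace k))) : ℝ :=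
  ((Fintype.card (Fin n → Bool) : ℝ) ^ n)⁻¹ *
    ∑ x : Fin n → Fin n → Bool, infDistProfile η (signMat x)

theorem ncard_lt_abs_infDistProfile_sub_mean_le {n k : ℕ} [NeZero n]
    (η : LevyProkhorov (ProbabilityMeasure (POperator.ProfileSpace k))) {t : ℝ} (ht : 0 < t) :
    ({x : Fin n → Fin n → Bool |
      t < |infDistProfile η (signMat x) - meanInfDistProfile n η|}.ncard : ℝ) ≤
      2 * ((2 ^ n) ^ n * Real.exp (-(n * t ^ 2 / 2))) := by
  have h := ncard_lt_abs_sub_mean_le (X := Fin n → Bool) (NeZero.pos n)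
    (f := fun x => infDistProfile η (signMat x)) (fun x y i hxy => ?_) ht
  · simpa [meanInfDistProfile] using h
  · refine abs_infDistProfile_sub_le (j₀ := i) (fun j hj i' => ?_) η
    simp only [signMat, Matrix.of_apply, hxy j hj]

/-! ### Almost sure behaviour of random sign matrices -/

theorem signLaw_Ioi {n : ℕ} (hn : 0 < n) : signLaw n (Set.Ioi 0) = 2⁻¹ := by
  have h : 0 < (Real.sqrt n)⁻¹ := inv_pos.2 (Real.sqrt_pos.2 (by exact_mod_cast hn))
  simp [signLaw, Set.indicator, h, -inv_pos]

theorem signLaw_Iic {n : ℕ} (hn : 0 < n) : signLaw n (Set.Iic 0) = 2⁻¹ := by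
  have h : 0 < (Real.sqrt n)⁻¹ := inv_pos.2 (Real.sqrt_pos.2 (by exact_mod_cast hn))
  simp [signLaw, Set.indicator, h.le, h.not_ge, -inv_nonpos]

theorem signLaw_compl_pair (n : ℕ) :
    signLaw n {(Real.sqrt n)⁻¹, -(Real.sqrt n)⁻¹}ᶜ = 0 := by
  simp [signLaw]

section Random

variable {Ω : Type*} [MeasurableSpace Ω] {P : Measure Ω}

/-- The law of the random Boolean array `b` is bounded by the uniform distribution. -/
def IsUniformSigns (P : Measure Ω) {n : ℕ} (b : Ω → Fin n → Fin n → Bool) : Prop :=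
  ∀ B : Set (Fin n → Fin n → Bool), P {ω | b ω ∈ B} ≤ ENNReal.ofReal (B.ncard / (2 ^ n) ^ n)

theorem isUniformSigns_of_forall_eq {n : ℕ} {b : Ω → Fin n → Fin n → Bool}
    (h : ∀ x, P {ω | b ω = x} ≤ ((2 : ℝ≥0∞)⁻¹ ^ n) ^ n) : IsUniformSigns P b := by
  classical
  intro B
  have hB : {ω | b ω ∈ B} = ⋃ x ∈ B.toFinset, {ω | b ω = x} := by ext; simp
  rw [hB, Set.ncard_eq_toFinset_card']
  calc _ ≤ ∑ x ∈ B.toFinset, P {ω | b ω = x} := measure_biUnion_finset_le _ _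
    _ ≤ ∑ _x ∈ B.toFinset, ((2 : ℝ≥0∞)⁻¹ ^ n) ^ n := Finset.sum_le_sum fun x _ => h x
    _ = ENNReal.ofReal (B.toFinset.card / (2 ^ n) ^ n) := by
      rw [Finset.sum_const, nsmul_eq_mul, ENNReal.ofReal_div_of_pos (by positivity),
        ENNReal.ofReal_natCast, ENNReal.ofReal_pow (by positivity),
        ENNReal.ofReal_pow (by positivity), ENNReal.ofReal_ofNat, ENNReal.div_eq_inv_mul, mul_comm,
        ENNReal.inv_pow, ENNReal.inv_pow]

theorem IsRandomSignMatrix.exists_signMat {n : ℕ} (hn : 0 < n)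
    {H : Ω → Matrix (Fin n) (Fin n) ℝ} (hH : IsRandomSignMatrix P H) :
    ∃ b : Ω → Fin n → Fin n → Bool, (∀ᵐ ω ∂P, H ω = signMat (b ω)) ∧ IsUniformSigns P b := by
  have hpos : 0 < (Real.sqrt n)⁻¹ := inv_pos.2 (Real.sqrt_pos.2 (by exact_mod_cast hn))
  refine ⟨fun ω j i => decide (0 < H ω i j), ?_, isUniformSigns_of_forall_eq fun x => ?_⟩
  · have h1 : ∀ᵐ ω ∂P, ∀ i j, H ω i j = (Real.sqrt n)⁻¹ ∨ H ω i j = -(Real.sqrt n)⁻¹ := by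
      rw [ae_all_iff]
      intro i
      rw [ae_all_iff]
      intro j
      rw [ae_iff]
      have := (hH.hasLaw i j).measure_eq
        (p := fun y => y ∈ ({(Real.sqrt n)⁻¹, -(Real.sqrt n)⁻¹} : Set ℝ)ᶜ)
        ((Set.toFinite _).measurableSet.compl)
      simpa using this.trans (signLaw_compl_pair n)
    filter_upwards [h1] with ω hω
    ext i j
    rcases hω i j with h | h
    · simp [signMat, boolSign, h, hpos, -inv_pos]
    · simp [signMat, boolSign, h, hpos.not_gt, -inv_pos]
  · set s : Fin n × Fin n → Set ℝ := fun p => if x p.2 p.1 then Set.Ioi 0 else Set.Iic 0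
    have hs : ∀ p, MeasurableSet (s p) := by
      intro p
      simp only [s]
      split_ifs
      · exact measurableSet_Ioi
      · exact measurableSet_Iic
    have h1 := hH.indep.measure_inter_preimage_eq_mul Finset.univ fun p _ => hs p
    have h2 : ∀ p : Fin n × Fin n, P ((fun ω => H ω p.1 p.2) ⁻¹' s p) = 2⁻¹ := by
      intro p
      refine ((hH.hasLaw p.1 p.2).measure_eq (p := fun y => y ∈ s p) (hs p)).trans ?_
      show signLaw n (s p) = _
      simp only [s]
      split_ifs
      · exact signLaw_Ioi hn
      · exact signLaw_Iic hn
    simp only [h2, Finset.prod_const, Finset.card_univ, Fintype.card_prod, Fintype.card_fin] at h1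
    rw [pow_mul] at h1
    rw [← h1]
    refine measure_mono fun ω hω => ?_
    simp only [Set.mem_iInter, Finset.mem_univ, true_imp_iff]
    intro p
    have hω' : decide (0 < H ω p.1 p.2) = x p.2 p.1 := congrFun (congrFun hω p.2) p.1
    simp only [Set.mem_preimage, s, ← hω']
    by_cases h : 0 < H ω p.1 p.2
    · simp [h]
    · simp [h, not_lt.1 h]

theorem eventually_atTop_of_finite {p : ℕ+ → Prop} (h : {n | ¬ p n}.Finite) :
    ∀ᶠ n in atTop, p n := by
  obtain ⟨N, hN⟩ := h.bddAbove
  filter_upwards [eventually_gt_atTop N] with n hn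
  by_contra hcon
  exact absurd (hN hcon) (not_le.2 hn)

variable {b : ∀ n : ℕ+, Ω → Fin n → Fin n → Bool}

/-- The first Borel–Cantelli lemma uses only summability of the probabilities, so the arrays for
different `n` may be dependent in any way. -/
theorem ae_eventually_notMem_of_ncard_le (hb : ∀ n, IsUniformSigns P (b n))
    {B : ∀ n : ℕ+, Set (Fin n → Fin n → Bool)} {r : ℝ} (hr : 0 < r)
    (hB : ∀ n : ℕ+, ((B n).ncard : ℝ) ≤ 2 * ((2 ^ (n : ℕ)) ^ (n : ℕ) * Real.exp (-(r * n)))) :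
    ∀ᵐ ω ∂P, ∀ᶠ n in atTop, b n ω ∉ B n := by
  have hsum : Summable fun n : ℕ+ => 2 * Real.exp (((n : ℕ) : ℝ) * (-r)) :=
    ((Real.summable_exp_nat_mul_iff.2 (neg_lt_zero.2 hr)).comp_injective
      PNat.coe_injective).mul_left 2
  have h1 : ∑' n : ℕ+, P {ω | b n ω ∈ B n} ≠ ∞ := by
    refine ne_top_of_le_ne_top hsum.tsum_ofReal_ne_top (ENNReal.tsum_le_tsum fun n => ?_)
    refine (hb n (B n)).trans (ENNReal.ofReal_le_ofReal ?_)
    rw [div_le_iff₀ (by positivity)]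
    refine (hB n).trans (le_of_eq ?_)
    rw [show -(r * ((n : ℕ) : ℝ)) = (n : ℕ) * (-r) by ring]
    ring
  filter_upwards [ae_finite_setOfPred_mem h1] with ω hω
  refine eventually_atTop_of_finite (hω.subset fun n hn => ?_)
  simpa using hn

theorem ae_eventually_isRowBounded (hb : ∀ n, IsUniformSigns P (b n)) :
    ∀ᵐ ω ∂P, ∀ᶠ n in atTop, (signMat (b n ω)).IsRowBounded 4 := by
  filter_upwards [ae_eventually_notMem_of_ncard_le hb two_pos
    fun n => ncard_not_isRowBounded_le n.pos] with ω hω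
  filter_upwards [hω] with n hn
  simpa using hn

theorem ae_tendsto_infDistProfile_sub_mean (hb : ∀ n, IsUniformSigns P (b n)) {k : ℕ}
    (η : LevyProkhorov (ProbabilityMeasure (POperator.ProfileSpace k))) :
    ∀ᵐ ω ∂P, Tendsto (fun n : ℕ+ => infDistProfile η (signMat (b n ω)) - meanInfDistProfile n η)
      atTop (𝓝 0) := by
  have h1 : ∀ᵐ ω ∂P, ∀ m : ℕ, ∀ᶠ n : ℕ+ in atTop,
      |infDistProfile η (signMat (b n ω)) - meanInfDistProfile n η| ≤ 1 / ((m : ℝ) + 1) := by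
    rw [ae_all_iff]
    intro m
    have hm : (0 : ℝ) < 1 / ((m : ℝ) + 1) := by positivity
    filter_upwards [ae_eventually_notMem_of_ncard_le hb
      (r := (1 / ((m : ℝ) + 1)) ^ 2 / 2) (by positivity) fun n => by
        refine (ncard_lt_abs_infDistProfile_sub_mean_le η hm).trans (le_of_eq ?_)
        ring_nf] with ω hω
    filter_upwards [hω] with n hn
    simpa using hn
  filter_upwards [h1] with ω hω
  rw [Metric.tendsto_nhds]
  intro ε hε
  obtain ⟨m, hm⟩ := exists_nat_one_div_lt hε
  filter_upwards [hω m] with n hn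
  rw [Real.dist_eq, sub_zero]
  exact hn.trans_lt hm

end Random

/-! ### Nets and typical sequences -/

theorem infEDist_profile_le_add_ofReal {n k : ℕ} [NeZero n] {H H' : Matrix (Fin n) (Fin n) ℝ}
    {η : LevyProkhorov (ProbabilityMeasure (POperator.ProfileSpace k))} {t : ℝ}
    (h : |infDistProfile η H - infDistProfile η H'| ≤ t) :
    Metric.infEDist η (H'.toPOperator.profile k) ≤
      Metric.infEDist η (H.toPOperator.profile k) + ENNReal.ofReal t := by
  rw [← ENNReal.ofReal_toReal (infEDist_profile_ne_top H.toPOperator η),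
    ← ENNReal.ofReal_toReal (infEDist_profile_ne_top H'.toPOperator η),
    ← ENNReal.ofReal_add ENNReal.toReal_nonneg ((abs_nonneg _).trans h)]
  refine ENNReal.ofReal_le_ofReal ?_
  have := (abs_le.1 h).1
  unfold infDistProfile at this
  linarith

theorem infEDist_profile_le_of_net {n k : ℕ} [NeZero n] {H H' : Matrix (Fin n) (Fin n) ℝ}
    {N : Set (LevyProkhorov (ProbabilityMeasure (POperator.ProfileSpace k)))} {t : ℝ}
    (hN : H.toPOperator.profile k ⊆ ⋃ y ∈ N, Metric.eball y (ENNReal.ofReal t))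
    (h : ∀ η ∈ N, |infDistProfile η H - infDistProfile η H'| ≤ t)
    {x : LevyProkhorov (ProbabilityMeasure (POperator.ProfileSpace k))}
    (hx : x ∈ H.toPOperator.profile k) :
    Metric.infEDist x (H'.toPOperator.profile k) ≤ 3 * ENNReal.ofReal t := by
  obtain ⟨η, hη, hxη⟩ := Set.mem_iUnion₂.1 (hN hx)
  have hxη' : edist x η ≤ ENNReal.ofReal t := le_of_lt hxη
  calc Metric.infEDist x (H'.toPOperator.profile k)
      ≤ Metric.infEDist η (H'.toPOperator.profile k) + edist x η :=
        Metric.infEDist_le_infEDist_add_edist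
    _ ≤ (Metric.infEDist η (H.toPOperator.profile k) + ENNReal.ofReal t) + ENNReal.ofReal t :=
        add_le_add (infEDist_profile_le_add_ofReal (h η hη)) hxη'
    _ ≤ (ENNReal.ofReal t + ENNReal.ofReal t) + ENNReal.ofReal t := by
        gcongr
        refine (Metric.infEDist_le_edist_of_mem hx).trans ?_
        rwa [edist_comm]
    _ = 3 * ENNReal.ofReal t := by ring

theorem exists_profile_net (C : ℝ) (k m : ℕ) :
    ∃ N : Set (LevyProkhorov (ProbabilityMeasure (POperator.ProfileSpace k))), N.Finite ∧
      ∀ (n : ℕ) [NeZero n] (H : Matrix (Fin n) (Fin n) ℝ), H.IsRowBounded C →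
        H.toPOperator.profile k ⊆ ⋃ y ∈ N, Metric.eball y (ENNReal.ofReal (1 / ((m : ℝ) + 1))) := by
  obtain ⟨N, hN, hN'⟩ := EMetric.totallyBounded_iff.1
    (POperator.totallyBounded_iUnion_profile C k) (ENNReal.ofReal (1 / ((m : ℝ) + 1)))
    (ENNReal.ofReal_pos.2 (by positivity))
  exact ⟨N, hN, fun n hn H hH x hx => hN' ⟨n, hn, H, hH, hx⟩⟩

/-- A finite net of all `k`-profiles of uniformly bounded matrices. -/
noncomputable def profileNet (C : ℝ) (k m : ℕ) :
    Set (LevyProkhorov (ProbabilityMeasure (POperator.ProfileSpace k))) :=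
  (exists_profile_net C k m).choose

theorem finite_profileNet (C : ℝ) (k m : ℕ) : (profileNet C k m).Finite :=
  (exists_profile_net C k m).choose_spec.1

theorem Matrix.IsRowBounded.profile_subset {C : ℝ} {n : ℕ} [NeZero n]
    {H : Matrix (Fin n) (Fin n) ℝ} (hH : H.IsRowBounded C) (k m : ℕ) : H.toPOperator.profile k ⊆
      ⋃ y ∈ profileNet C k m, Metric.eball y (ENNReal.ofReal (1 / ((m : ℝ) + 1))) :=
  (exists_profile_net C k m).choose_spec.2 n H hH

/-- Matrices behaving typically: eventually bounded, and with the distances to the points of all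
nets close to their means. -/
structure IsTypical (b : ∀ n : ℕ+, Fin n → Fin n → Bool) : Prop where
  isRowBounded : ∀ᶠ n in atTop, (signMat (b n)).IsRowBounded 4
  tendsto : ∀ k m, ∀ η ∈ profileNet 4 k m, Tendsto (fun n : ℕ+ =>
    infDistProfile η (signMat (b n)) - meanInfDistProfile n η) atTop (𝓝 0)

theorem ae_isTypical {Ω : Type*} [MeasurableSpace Ω] {P : Measure Ω}
    {b : ∀ n : ℕ+, Ω → Fin n → Fin n → Bool} (hb : ∀ n, IsUniformSigns P (b n)) :
    ∀ᵐ ω ∂P, IsTypical fun n => b n ω := by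
  have h : ∀ᵐ ω ∂P, ∀ k m, ∀ η ∈ profileNet 4 k m, Tendsto (fun n : ℕ+ =>
      infDistProfile η (signMat (b n ω)) - meanInfDistProfile n η) atTop (𝓝 0) := by
    rw [ae_all_iff]
    intro k
    rw [ae_all_iff]
    intro m
    rw [ae_ball_iff (finite_profileNet 4 k m).countable]
    exact fun η _ => ae_tendsto_infDistProfile_sub_mean hb η
  filter_upwards [ae_eventually_isRowBounded hb, h] with ω h1 h2
  exact ⟨h1, h2⟩

/-- Both distances to a net point are close to the same mean, so the means cancel. Agreement at the
finitely many points of a `1 / (m + 1)`-net bounds the Hausdorff distance by `3 / (m + 1)`. -/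
theorem IsTypical.tendsto_hausdorffEDist {b b' : ∀ n : ℕ+, Fin n → Fin n → Bool}
    (hb : IsTypical b) (hb' : IsTypical b') (k : ℕ) :
    Tendsto (fun n => Metric.hausdorffEDist ((signMat (b n)).toPOperator.profile k)
      ((signMat (b' n)).toPOperator.profile k)) atTop (𝓝 0) := by
  rw [ENNReal.tendsto_nhds_zero]
  intro ε hε
  obtain ⟨d, hd, hdε⟩ := ENNReal.lt_iff_exists_nnreal_btwn.1
    (ENNReal.div_pos hε.ne' (by simp : (3 : ℝ≥0∞) ≠ ∞))
  obtain ⟨m, hm⟩ := exists_nat_one_div_lt (show (0 : ℝ) < d by simpa using hd)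
  have hε' : 3 * ENNReal.ofReal (1 / ((m : ℝ) + 1)) ≤ ε := by
    calc 3 * ENNReal.ofReal (1 / ((m : ℝ) + 1)) ≤ 3 * ENNReal.ofReal d := by gcongr
      _ ≤ 3 * (ε / 3) := by
        rw [ENNReal.ofReal_coe_nnreal]
        gcongr
      _ ≤ ε := ENNReal.mul_div_le
  have hnet : ∀ᶠ n : ℕ+ in atTop, ∀ η ∈ profileNet 4 k m,
      |infDistProfile η (signMat (b n)) - infDistProfile η (signMat (b' n))| ≤
        1 / ((m : ℝ) + 1) := by
    rw [eventually_all_finite (finite_profileNet 4 k m)]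
    intro η hη
    have h1 := (hb.tendsto k m η hη).sub (hb'.tendsto k m η hη)
    simp only [sub_sub_sub_cancel_right, sub_zero] at h1
    filter_upwards [Metric.tendsto_nhds.1 h1 _ (Nat.one_div_pos_of_nat (α := ℝ) (n := m))]
      with n hn
    rw [Real.dist_eq, sub_zero] at hn
    exact hn.le
  filter_upwards [hnet, hb.isRowBounded, hb'.isRowBounded] with n h1 h2 h3
  refine le_trans (Metric.hausdorffEDist_le_of_infEDist (fun x hx => ?_) fun x hx => ?_) hε'
  · exact infEDist_profile_le_of_net (h2.profile_subset k m) h1 hx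
  · refine infEDist_profile_le_of_net (h3.profile_subset k m)
      (fun η hη => ?_) hx
    rw [abs_sub_comm]
    exact h1 η hη

/-! ### Convergence in `d_M` and extraction of the subsequence -/

namespace POperator

theorem hausdorffEDist_profile_le_one (A B : POperator) (k : ℕ) :
    Metric.hausdorffEDist (A.profile k) (B.profile k) ≤ 1 := by
  have h : ∀ x y : LevyProkhorov (ProbabilityMeasure (ProfileSpace k)), edist x y ≤ 1 := by
    intro x y
    rw [LevyProkhorov.edist_probabilityMeasure_def]
    exact (levyProkhorovEDist_le_max_measure_univ _ _).trans (by simp)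
  obtain ⟨a, ha⟩ := A.profile_nonempty k
  obtain ⟨b, hb⟩ := B.profile_nonempty k
  exact Metric.hausdorffEDist_le_of_mem_edist (fun x _ => ⟨b, hb, h x b⟩)
    (fun y _ => ⟨a, ha, h y a⟩)

theorem dM_triangle (A B C : POperator) : dM A C ≤ dM A B + dM B C := by
  unfold dM
  rw [← ENNReal.tsum_add]
  refine ENNReal.tsum_le_tsum fun k => ?_
  rw [← mul_add]
  gcongr
  exact Metric.hausdorffEDist_triangle

theorem tendsto_dM {ι : Type*} {l : Filter ι} {A B : ι → POperator}
    (h : ∀ k, Tendsto (fun i => Metric.hausdorffEDist ((A i).profile k) ((B i).profile k)) l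
      (𝓝 0)) : Tendsto (fun i => dM (A i) (B i)) l (𝓝 0) := by
  rw [ENNReal.tendsto_nhds_zero]
  intro ε hε
  have hε2 : 0 < ε / 2 := ENNReal.half_pos hε.ne'
  obtain ⟨K, hK⟩ := (ENNReal.tendsto_nhds_zero.1 (ENNReal.tendsto_pow_atTop_nhds_zero_of_lt_one
    (r := 2⁻¹) (by simp)) _ hε2).exists
  have hsum : Tendsto (fun i => ∑ k ∈ Finset.range K, (2⁻¹ : ℝ≥0∞) ^ (k + 1) *
      Metric.hausdorffEDist ((A i).profile (k + 1)) ((B i).profile (k + 1))) l (𝓝 0) := by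
    have := tendsto_finsetSum (Finset.range K) fun k _ =>
      ENNReal.Tendsto.const_mul (a := (2⁻¹ : ℝ≥0∞) ^ (k + 1)) (h (k + 1)) (.inr (by finiteness))
    simpa using this
  filter_upwards [ENNReal.tendsto_nhds_zero.1 hsum _ hε2] with i hi
  unfold dM
  rw [← ENNReal.summable.sum_add_tsum_nat_add' (k := K)]
  refine (add_le_add hi ?_).trans (ENNReal.add_halves ε).le
  calc _ ≤ ∑' k : ℕ, (2⁻¹ : ℝ≥0∞) ^ K * (2⁻¹ : ℝ≥0∞) ^ (k + 1) := by
        refine ENNReal.tsum_le_tsum fun k => ?_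
        refine (mul_le_of_le_one_right' (hausdorffEDist_profile_le_one _ _ _)).trans_eq ?_
        rw [← pow_add]
        congr 1
        ring
    _ = (2⁻¹ : ℝ≥0∞) ^ K := by
        rw [ENNReal.tsum_mul_left, ENNReal.tsum_geometric_add_one, ENNReal.one_sub_inv_two, inv_inv,
          ENNReal.inv_mul_cancel two_ne_zero ENNReal.ofNat_ne_top, mul_one]
    _ ≤ ε / 2 := hK

end POperator

theorem Matrix.isRowBounded_zero (n : ℕ) (C : ℝ) (hC : 0 ≤ C) :
    (0 : Matrix (Fin n) (Fin n) ℝ).IsRowBounded C where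
  sq_le v _ := by simpa using sq_nonneg C
  abs_le v := by
    simpa using mul_nonneg hC (Real.sqrt_nonneg (∫ j, v j ^ 2 ∂uniformFin n))

/-- An almost sure property has a witness; the product of the uniform measures is one convenient
coupling. -/
theorem exists_isTypical : ∃ b : ∀ n : ℕ+, Fin n → Fin n → Bool, IsTypical b := by
  let μ : ∀ n : ℕ+, Measure (Fin n → Fin n → Bool) := fun _ => uniformOn Set.univ
  have h : ∀ n, IsUniformSigns (Measure.infinitePi μ)
      fun ω : ∀ n : ℕ+, Fin n → Fin n → Bool => ω n := by
    intro n
    refine isUniformSigns_of_forall_eq fun x => ?_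
    have h1 := (measurePreserving_eval_infinitePi μ n).measure_preimage
      (s := {x}) (measurableSet_singleton x).nullMeasurableSet
    refine (h1.trans ?_).le
    show uniformOn Set.univ {x} = _
    rw [uniformOn_univ]
    simp [ENNReal.inv_pow]
  exact (ae_isTypical h).exists

theorem exists_infinite_tendsto {f : ℕ+ → ℝ≥0∞} {S' : Set ℕ+} {l : Filter ℕ+} [l.NeBot]
    (hl : l ≤ atTop ⊓ 𝓟 S') (hf : Tendsto f l (𝓝 0)) :
    ∃ S ⊆ S', S.Infinite ∧ Tendsto f (atTop ⊓ 𝓟 S) (𝓝 0) := by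
  have hne : (atTop ⊓ 𝓟 S' ⊓ comap f (𝓝 0)).NeBot :=
    NeBot.mono ‹_› (le_inf hl (tendsto_iff_comap.1 hf))
  obtain ⟨x, hx⟩ := exists_seq_tendsto (atTop ⊓ 𝓟 S' ⊓ comap f (𝓝 0))
  rw [tendsto_inf, tendsto_inf, tendsto_principal, tendsto_comap_iff] at hx
  obtain ⟨⟨hx1, hx2⟩, hx3⟩ := hx
  obtain ⟨N, hN⟩ := eventually_atTop.1 hx2
  refine ⟨x '' Set.Ici N, ?_, ?_, ?_⟩
  · rintro _ ⟨j, hj, rfl⟩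
    exact hN j hj
  · intro hfin
    obtain ⟨M, hM⟩ := hfin.bddAbove
    obtain ⟨j, hj, hj'⟩ := ((hx1.eventually (eventually_gt_atTop M)).and
      (eventually_ge_atTop N)).exists
    exact absurd (hM ⟨j, hj', rfl⟩) (not_le.2 hj)
  · rw [ENNReal.tendsto_nhds_zero]
    intro ε hε
    obtain ⟨J, hJ⟩ := eventually_atTop.1 (ENNReal.tendsto_nhds_zero.1 hx3 ε hε)
    -- The sequence may repeat or be out of order; a point of `S` beyond `M` can only come from an
    -- index at least `J`.
    obtain ⟨M, hM⟩ := ((Set.finite_Iio J).image x).bddAbove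
    rw [eventually_inf_principal]
    filter_upwards [eventually_gt_atTop M]
    rintro _ hn ⟨j, -, rfl⟩
    refine hJ j ?_
    by_contra hj
    exact absurd (hM ⟨j, not_le.1 hj, rfl⟩) (not_le.2 hn)

theorem exists_subsequence_tendsto_dM {b : ∀ n : ℕ+, Fin n → Fin n → Bool} (hb : IsTypical b)
    {S' : Set ℕ+} (hS' : S'.Infinite) :
    ∃ A : POperator, ∃ S ⊆ S', S.Infinite ∧
      Tendsto (fun n => POperator.dM (signMat (b n)).toPOperator A) (atTop ⊓ 𝓟 S) (𝓝 0) := by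
  classical
  have hne : (atTop ⊓ 𝓟 S').NeBot := by
    rw [← frequently_mem_iff_neBot, frequently_atTop]
    intro N
    obtain ⟨n, hn, hn'⟩ := hS'.exists_gt N
    exact ⟨n, hn'.le, hn⟩
  set U : Ultrafilter ℕ+ := Ultrafilter.of (atTop ⊓ 𝓟 S')
  have hU : (U : Filter ℕ+) ≤ atTop ⊓ 𝓟 S' := Ultrafilter.of_le _
  -- The limit theorem needs the bound at every index. Replacing the unbounded matrices by `0`
  -- changes nothing eventually.
  set R : ∀ n : ℕ+, Matrix (Fin n) (Fin n) ℝ := fun n =>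
    if (signMat (b n)).IsRowBounded 4 then signMat (b n) else 0
  have hR : ∀ n, (R n).IsRowBounded 4 := by
    intro n
    simp only [R]
    split_ifs with h
    · exact h
    · exact Matrix.isRowBounded_zero _ _ (by norm_num)
  obtain ⟨A, hA⟩ := exists_tendsto_hausdorffEDist_profile U hR
  have hRA : Tendsto (fun n => POperator.dM (signMat (b n)).toPOperator A) U (𝓝 0) := by
    refine (POperator.tendsto_dM hA).congr' ?_
    filter_upwards [(hU.trans inf_le_left) hb.isRowBounded] with n hn
    simp only [R]
    rw [if_pos hn]
  exact ⟨A, exists_infinite_tendsto hU hRA⟩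

theorem proposition11p1 (S' : Set ℕ+) (hS' : S'.Infinite) :
    ∃ (A : POperator) (S : Set ℕ+), S ⊆ S' ∧ S.Infinite ∧
      ∀ (Ω : Type*) [MeasurableSpace Ω] (P : Measure Ω) [IsProbabilityMeasure P]
        (H : (n : ℕ+) → Ω → Matrix (Fin n) (Fin n) ℝ),
        (∀ n, IsRandomSignMatrix P (H n)) →
        ∀ᵐ ω ∂P, Tendsto (fun n => POperator.dM (H n ω).toPOperator A) (atTop ⊓ 𝓟 S) (𝓝 0) := by
  -- The reference sequence, and with it `A` and `S`, is fixed before any random matrices are given.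
  obtain ⟨b, hb⟩ := exists_isTypical
  obtain ⟨A, S, hS, hS_inf, hA⟩ := exists_subsequence_tendsto_dM hb hS'
  refine ⟨A, S, hS, hS_inf, fun Ω _ P _ H hH => ?_⟩
  choose c hc hc' using fun n : ℕ+ => (hH n).exists_signMat n.pos
  filter_upwards [ae_all_iff.2 hc, ae_isTypical hc'] with ω h1 h2
  have h3 := (POperator.tendsto_dM fun k => h2.tendsto_hausdorffEDist hb k).mono_left
    (inf_le_left : atTop ⊓ 𝓟 S ≤ atTop)
  have h4 := h3.add hA
  rw [add_zero] at h4
  refine tendsto_of_tendsto_of_tendsto_of_le_of_le tendsto_const_nhds h4 (fun _ => bot_le)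
    fun n => ?_
  simp only [h1]
  exact POperator.dM_triangle _ _ _
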